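/- **Setting.** Consider the plant $\dot x = Ax + Bu + B_v v$ with $x\in\mathbb R^n$, $u\in\mathbb R^m$, unknown input $v\in\mathbb R^{m_v}$, where $N_c$ controller nodes generate $u^1,\dots,u^{N_c}$ with $Bu=\sum_{\iota=1}^{N_c} B^\iota u^\iota$, and let $\tilde B$ satisfy $B=[B^1\ B^2\ \cdots\ B^{N_c}]\tilde B$. For $i=1,\dots,N$, observer node $i$ measures $y_i=C_ix$ ($C_i$ of full row rank) and receives a local control input $u_i$ formed linearly from $u^1,\dots,u^{N_c}$ (for instance a selection of them); correspondingly $Bu+B_vv=B_iu_i+B_{-i}u_{-i}$ with $B_{-i}$ of full column rank and $u_{-i}$ unavailable to node $i$. Vectors carry the Euclidean norm, matrices the induced 2-norm; $h(\omega)=\omega/\|\omega\|$ for $\omega\neq0$ and $h(0)=0$. For each $i$ let $T_{id}\in\mathbb R^{n\times\delta_i}$, $E_i$, $F_i$, $G_i$ be matrices with $T_{id}^\top T_{id}=I$, $G_iC_iB_{-i}=T_{id}^\top B_{-i}$, $E_iT_{id}^\top+(G_iC_i-T_{id}^\top)A+(F_i-E_iG_i)C_i=0$, and such that either all eigenvalues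 of $E_i$ have negative real part, or $E_i=0$ and $G_iC_i=T_{id}^\top$. Let $T_{iu}\in\mathbb R^{n\times(n-\delta_i)}$ satisfy $T_{id}^\top T_{iu}=0$, $T_{iu}^\top T_{iu}=I$, $T_{iu}T_{iu}^\top=I-T_{id}T_{id}^\top$. Put $\bar G_i=T_{id}G_i$, $\bar E_i=T_{id}E_iT_{id}^\top+T_{iu}T_{iu}^\top A$, $\bar F_i=T_{id}F_i+T_{iu}T_{iu}^\top A\bar G_i$, $\bar B_i=(I-\bar G_iC_i)B_i$. The observer nodes communicate over an undirected graph without self-loops, with weights $a_{ij}=a_{ji}$, positive on edges and zero otherwise. Observer node $i$ is $$\dot z_i=\bar E_iz_i+\bar F_iy_i+\bar B_iu_i-\gamma_iT_{iu}\varepsilon_{iu}-\gamma_{is}T_{iu}h(\varepsilon_{iu}),\qquad \hat x_i=z_i+\bar G_iy_i,\qquad \varepsilon_{iu}=T_{iu}^\top\sum_{j=1}^N a_{ij}(\hat x_i-\hat x_j),$$ $$\dot\gamma_i=\phi_i\|\varepsilon_{iu}\|^2,\qquad \dot\gamma_{is}=\phi_{is}\|\varepsilon_{iu}\|,$$ with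 $z_i(0)=0$ and $\phi_i,\phi_{is},\gamma_i(0),\gamma_{is}(0)>0$. **Theorem.** Assume that $\|v(t)\|\le\bar v$ for all $t\ge0$, that $(A,B)$ is stabilizable, that there is a matrix $X_v$ with $BX_v=B_v$, that the graph is connected, and that $\sum_{i=1}^N\operatorname{Im}T_{id}=\mathbb R^n$. Let $K^1,\dots,K^{N_c}$ and a symmetric positive definite matrix $P$ satisfy $$\Big(A+\sum_{\iota=1}^{N_c}B^\iota K^\iota\Big)^{\!\top}P+P\Big(A+\sum_{\iota=1}^{N_c}B^\iota K^\iota\Big)<0,$$ let $\beta^\iota\ge\bar v\,\|\tilde BX_v\|$ for all $\iota$, and for each $\iota$ let $i'=i'(\iota)\in\{1,\dots,N\}$ be any observer node. Apply $$u^\iota=K^\iota\hat x_{i'}-\beta^\iota h\big((B^\iota)^\top P\hat x_{i'}\big),\qquad \iota=1,\dots,N_c.$$ Solutions of the resulting discontinuous closed loop are understood in the generalized (Filippov) sense: they are locally absolutely continuous on $[0,\infty)$ and satisfy the equations for almost every $t$, where each $h(\omega)$ may take any value in the closed unit ball when $\omega=0$ (the same value of $u^\iota$ entering the plant and the observers).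 Then, for every initial state $x(0)$ and every such solution, $$\lim_{t\to\infty}\|x(t)\|=0,\qquad \lim_{t\to\infty}\|\hat x_i(t)-x(t)\|=0\quad (i=1,\dots,N),$$ and the adaptive gains $\gamma_i$ and $\gamma_{is}$ remain bounded on $[0,\infty)$ for every $i$. -/

import Mathlib

open Matrix MeasureTheory Filter Topology

noncomputable section

namespace DistSMC

/-- Euclidean norm of a real coordinate vector. -/
def l2norm {k : Type*} [Fintype k] (w : k → ℝ) : ℝ :=
  ‖(WithLp.toLp 2 w : EuclideanSpace ℝ k)‖

/-- Induced 2-norm of a real matrix. -/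
def opNorm2 {k l : Type*} [Fintype k] [Fintype l] [DecidableEq l] (M : Matrix k l ℝ) : ℝ :=
  ‖LinearMap.toContinuousLinearMap (Matrix.toEuclideanLin M)‖

/-- The discontinuous function `h(ω) = ω / ‖ω‖` for `ω ≠ 0`, `h(0) = 0`. -/
def h {k : Type*} [Fintype k] (ω : k → ℝ) : k → ℝ :=
  open Classical in if ω = 0 then 0 else (l2norm ω)⁻¹ • ω

/-- The convexified (Filippov) set-valued version of `h`: the singleton `{h ω}` where `h` is
continuous, i.e. for `ω ≠ 0`, and the closed Euclidean unit ball at the discontinuity `ω = 0`. -/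
def hSet {k : Type*} [Fintype k] (ω : k → ℝ) : Set (k → ℝ) :=
  {s | (ω ≠ 0 → s = h ω) ∧ (ω = 0 → l2norm s ≤ 1)}

/-- The single-valued law is one of the admissible values of the set-valued one. -/
theorem h_mem_hSet {k : Type*} [Fintype k] (ω : k → ℝ) : h ω ∈ hSet ω := by
  refine ⟨fun _ => rfl, fun hω => ?_⟩
  simp [h, hω, l2norm]

/-- `Re λ(M) < 0`: all complex eigenvalues lie in the open left half plane. -/
def IsHurwitz {k : Type*} [Fintype k] [DecidableEq k] (M : Matrix k k ℝ) : Prop :=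
  ∀ μ ∈ spectrum ℂ (M.map (algebraMap ℝ ℂ)), μ.re < 0

/-- Stabilizability of the pair `(A, B)`. -/
def IsStabilizable {n m : ℕ} (A : Matrix (Fin n) (Fin n) ℝ) (B : Matrix (Fin n) (Fin m) ℝ) :
    Prop :=
  ∃ K : Matrix (Fin m) (Fin n) ℝ, IsHurwitz (A + B * K)

/-- `a` is the adjacency matrix of a weighted undirected graph without self-loops whose
underlying simple graph is `G`: `a i j` is a positive weight on edges and zero elsewhere. -/
structure IsWeightedAdjacency {N : ℕ} (G : SimpleGraph (Fin N))
    (a : Matrix (Fin N) (Fin N) ℝ) : Prop where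
  symm : ∀ i j, a i j = a j i
  pos : ∀ i j, G.Adj i j → 0 < a i j
  zero : ∀ i j, ¬ G.Adj i j → a i j = 0

/-- The block row `[B¹ B² ⋯ B^{N_c}]`. -/
def blockRow {n Nc : ℕ} {b : Fin Nc → ℕ} (Bc : ∀ κ, Matrix (Fin n) (Fin (b κ)) ℝ) :
    Matrix (Fin n) ((κ : Fin Nc) × Fin (b κ)) ℝ :=
  Matrix.of fun r c => Bc c.1 r c.2

/-- The stacked vector `col(u¹, …, u^{N_c})`. -/
def stack {Nc : ℕ} {b : Fin Nc → ℕ} (u : ∀ κ, Fin (b κ) → ℝ) :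
    ((κ : Fin Nc) × Fin (b κ)) → ℝ :=
  fun c => u c.1 c.2

/-- Data of the multi-channel plant `x' = A x + B u + B_v v` with `N_c` controller nodes and `N`
observer nodes, where `B u = ∑ κ, B^κ u^κ`.  Observer node `i` measures `y_i = C_i x` and receives
the local control input `u_i = S_i col(u¹, …, u^{N_c})`, a signal formed from the inputs of
the controller nodes (for instance `S_i` selects the inputs of some of these nodes). The total input
term splits as `B_i u_i + B_{-i} u_{-i}`, where `u_{-i}` is unavailable to node `i`. -/
structure Plant (n m mv N Nc : ℕ) (b : Fin Nc → ℕ) (p q r : Fin N → ℕ) where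
  A : Matrix (Fin n) (Fin n) ℝ
  B : Matrix (Fin n) (Fin m) ℝ
  Bv : Matrix (Fin n) (Fin mv) ℝ
  /-- `Bc κ` is the input matrix `B^κ` of controller node `κ` -/
  Bc : ∀ κ, Matrix (Fin n) (Fin (b κ)) ℝ
  C : ∀ i, Matrix (Fin (p i)) (Fin n) ℝ
  S : ∀ i, Matrix (Fin (q i)) ((κ : Fin Nc) × Fin (b κ)) ℝ
  /-- `Bloc i` is `B_i` -/
  Bloc : ∀ i, Matrix (Fin n) (Fin (q i)) ℝ
  /-- `Bneg i` is `B_{-i}` -/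
  Bneg : ∀ i, Matrix (Fin n) (Fin (r i)) ℝ
  C_fullRowRank : ∀ i, (C i).rank = p i
  Bneg_fullColRank : ∀ i, (Bneg i).rank = r i
  split : ∀ i (u : ∀ κ, Fin (b κ) → ℝ) (v : Fin mv → ℝ), ∃ uneg : Fin (r i) → ℝ,
    ∑ κ, Bc κ *ᵥ u κ + Bv *ᵥ v = Bloc i *ᵥ (S i *ᵥ stack u) + Bneg i *ᵥ uneg

/-- The matrices used by the observer nodes: a strong detectability decomposition
`(T_id, E_i, F_i, G_i)` of `(A, B_{-i}, C_i)` for each `i`, completed by `T_iu`, and the positive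
step sizes of the adaptive laws. In the branch `E_i = 0` the decomposition is the static
one, in which `T_idᵀ x = G_i y_i` is read off from the output (hence `F_i = 0`, because `C_i` has
full row rank). -/
structure ObserverDesign {n m mv N Nc : ℕ} {b : Fin Nc → ℕ} {p q r : Fin N → ℕ}
    (S : Plant n m mv N Nc b p q r) (δ : Fin N → ℕ) where
  Td : ∀ i, Matrix (Fin n) (Fin (δ i)) ℝ
  E : ∀ i, Matrix (Fin (δ i)) (Fin (δ i)) ℝ
  F : ∀ i, Matrix (Fin (δ i)) (Fin (p i)) ℝ
  G : ∀ i, Matrix (Fin (δ i)) (Fin (p i)) ℝ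
  Td_orth : ∀ i, (Td i)ᵀ * Td i = 1
  decouple : ∀ i, G i * S.C i * S.Bneg i = (Td i)ᵀ * S.Bneg i
  sylvester : ∀ i, E i * (Td i)ᵀ + (G i * S.C i - (Td i)ᵀ) * S.A
    + (F i - E i * G i) * S.C i = 0
  stable : ∀ i, IsHurwitz (E i) ∨ (E i = 0 ∧ G i * S.C i = (Td i)ᵀ)
  Tu : ∀ i, Matrix (Fin n) (Fin (n - δ i)) ℝ
  Td_Tu : ∀ i, (Td i)ᵀ * Tu i = 0
  Tu_orth : ∀ i, (Tu i)ᵀ * Tu i = 1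
  Tu_compl : ∀ i, Tu i * (Tu i)ᵀ = 1 - Td i * (Td i)ᵀ
  φ : Fin N → ℝ
  φs : Fin N → ℝ
  φ_pos : ∀ i, 0 < φ i
  φs_pos : ∀ i, 0 < φs i

section Observer

variable {n m mv N Nc : ℕ} {b : Fin Nc → ℕ} {p q r : Fin N → ℕ}
  {S : Plant n m mv N Nc b p q r} {δ : Fin N → ℕ}

/-- Collective strong detectability: `∑ i, Im T_id = ℝⁿ`. -/
def ObserverDesign.CollectivelyDetectable (D : ObserverDesign S δ) : Prop :=
  ⨆ i, LinearMap.range (Matrix.mulVecLin (D.Td i)) = ⊤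

/-- `Ḡ_i = T_id G_i` -/
def ObserverDesign.Gbar (D : ObserverDesign S δ) (i : Fin N) : Matrix (Fin n) (Fin (p i)) ℝ :=
  D.Td i * D.G i

/-- `Ē_i = T_id E_i T_idᵀ + T_iu T_iuᵀ A` -/
def ObserverDesign.Ebar (D : ObserverDesign S δ) (i : Fin N) : Matrix (Fin n) (Fin n) ℝ :=
  D.Td i * D.E i * (D.Td i)ᵀ + D.Tu i * (D.Tu i)ᵀ * S.A

/-- `F̄_i = T_id F_i + T_iu T_iuᵀ A Ḡ_i` -/
def ObserverDesign.Fbar (D : ObserverDesign S δ) (i : Fin N) : Matrix (Fin n) (Fin (p i)) ℝ :=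
  D.Td i * D.F i + D.Tu i * (D.Tu i)ᵀ * S.A * D.Gbar i

/-- `B̄_i = (I - Ḡ_i C_i) B_i` -/
def ObserverDesign.Bbar (D : ObserverDesign S δ) (i : Fin N) : Matrix (Fin n) (Fin (q i)) ℝ :=
  (1 - D.Gbar i * S.C i) * S.Bloc i

/-- The state estimate `x̂_i = z_i + Ḡ_i y_i`, with `y_i = C_i x`. -/
def ObserverDesign.xhat (D : ObserverDesign S δ) (x : Fin n → ℝ) (z : Fin N → Fin n → ℝ)
    (i : Fin N) : Fin n → ℝ :=
  z i + D.Gbar i *ᵥ (S.C i *ᵥ x)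

/-- `ε_iu = T_iuᵀ ∑ j, a_ij (x̂_i - x̂_j)` -/
def ObserverDesign.epsu (D : ObserverDesign S δ) (a : Matrix (Fin N) (Fin N) ℝ)
    (x : Fin n → ℝ) (z : Fin N → Fin n → ℝ) (i : Fin N) : Fin (n - δ i) → ℝ :=
  (D.Tu i)ᵀ *ᵥ ∑ j, a i j • (D.xhat x z i - D.xhat x z j)

/-- The closed-loop differential inclusion at one time instant: `(dx, dz, dγ, dγs)` is an
admissible velocity at the state `(x, z, γ, γs)` under the unknown input value `v`.
Each occurrence of `h` takes a value `s κ`, `w i` in the convexified map `hSet`; the one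
resulting control signal `u^κ = K^κ x̂_{i'} - β^κ s^κ`, `i' = node κ`, enters both the plant and the
observers. -/
def ClosedLoop (D : ObserverDesign S δ) (a : Matrix (Fin N) (Fin N) ℝ)
    (K : ∀ κ, Matrix (Fin (b κ)) (Fin n) ℝ) (P : Matrix (Fin n) (Fin n) ℝ) (β : Fin Nc → ℝ)
    (node : Fin Nc → Fin N) (v : Fin mv → ℝ)
    (x : Fin n → ℝ) (z : Fin N → Fin n → ℝ) (γ γs : Fin N → ℝ)
    (dx : Fin n → ℝ) (dz : Fin N → Fin n → ℝ) (dγ dγs : Fin N → ℝ) : Prop :=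
  ∃ (s : ∀ κ, Fin (b κ) → ℝ) (w : ∀ i, Fin (n - δ i) → ℝ) (u : ∀ κ, Fin (b κ) → ℝ),
    (∀ κ, s κ ∈ hSet ((S.Bc κ)ᵀ *ᵥ (P *ᵥ D.xhat x z (node κ)))) ∧
    (∀ i, w i ∈ hSet (D.epsu a x z i)) ∧
    (∀ κ, u κ = K κ *ᵥ D.xhat x z (node κ) - β κ • s κ) ∧
    dx = S.A *ᵥ x + ∑ κ, S.Bc κ *ᵥ u κ + S.Bv *ᵥ v ∧
    (∀ i, dz i = D.Ebar i *ᵥ z i + D.Fbar i *ᵥ (S.C i *ᵥ x) + D.Bbar i *ᵥ (S.S i *ᵥ stack u)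
      - (γ i • (D.Tu i *ᵥ D.epsu a x z i) + γs i • (D.Tu i *ᵥ w i))) ∧
    (∀ i, dγ i = D.φ i * l2norm (D.epsu a x z i) ^ 2) ∧
    (∀ i, dγs i = D.φs i * l2norm (D.epsu a x z i))

/-- Solutions of the closed loop on `[0, ∞)`: locally absolutely continuous functions that satisfy
the differential inclusion at almost every time, with `z_i(0) = 0`, positive initial
gains and an arbitrary initial plant state. -/
structure IsClosedLoopSolution (D : ObserverDesign S δ) (a : Matrix (Fin N) (Fin N) ℝ)
    (K : ∀ κ, Matrix (Fin (b κ)) (Fin n) ℝ) (P : Matrix (Fin n) (Fin n) ℝ) (β : Fin Nc → ℝ)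
    (node : Fin Nc → Fin N) (v : ℝ → Fin mv → ℝ)
    (x : ℝ → Fin n → ℝ) (z : Fin N → ℝ → Fin n → ℝ) (γ γs : Fin N → ℝ → ℝ) : Prop where
  ac_x : ∀ T, 0 ≤ T → AbsolutelyContinuousOnInterval x 0 T
  ac_z : ∀ i T, 0 ≤ T → AbsolutelyContinuousOnInterval (z i) 0 T
  ac_γ : ∀ i T, 0 ≤ T → AbsolutelyContinuousOnInterval (γ i) 0 T
  ac_γs : ∀ i T, 0 ≤ T → AbsolutelyContinuousOnInterval (γs i) 0 T
  z_zero : ∀ i, z i 0 = 0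
  γ_zero : ∀ i, 0 < γ i 0
  γs_zero : ∀ i, 0 < γs i 0
  inclusion : ∀ᵐ t ∂(volume.restrict (Set.Ioi (0 : ℝ))),
    ∃ (dx : Fin n → ℝ) (dz : Fin N → Fin n → ℝ) (dγ dγs : Fin N → ℝ),
      HasDerivAt x dx t ∧ (∀ i, HasDerivAt (z i) (dz i) t) ∧
      (∀ i, HasDerivAt (γ i) (dγ i) t) ∧ (∀ i, HasDerivAt (γs i) (dγs i) t) ∧
      ClosedLoop D a K P β node (v t) (x t) (fun i => z i t) (fun i => γ i t) (fun i => γs i t)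
        dx dz dγ dγs

end Observer

end DistSMC

end

/-! One Lyapunov function treats plant, observers and gains together: the input hidden from an
observer depends on the state, so no bound on it is available beforehand. With e_i = x̂_i - x and L
the graph Laplacian, let V = xᵀPx + ½ Σ e_i·(Le)_i and let Q be the sum of (γ_i - g)²/(2φ_i) and
(γ_is - g)²/(2φ_is). Write X = ‖x‖, Y = Σ ‖T_iuᵀ(Le)_i‖ and Z = Σ ‖T_idᵀe_i‖.

The Sylvester and decoupling identities make T_idᵀe_i an autonomous signal y' = E_i y. Hence Z
decays exponentially by `IsHurwitz.exists_lyapunov`, the static observers contributing zero.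
Connectedness and collective detectability make the data behind Y and Z determine e, so every ‖e_i‖
is at most a multiple of Y + Z (`ObserverDesign.exists_norm_le`).

In the plant, unit-vector feedback beats the matched disturbance, leaving -λX² and terms of first
order in Y + Z (`Plant.exists_decay`). In the observers the adaptive terms supply -γ_i‖ε_iu‖² -
γ_is‖ε_iu‖, and the derivative of Q trades the actual gains for the fixed level g. A large g absorbs
every cross term containing Y, whence (V + Q)' ≤ -κV + C(Z + Z²)
(`ObserverDesign.exists_dissipation`).

The perturbation is integrable, so V + Q and the gains are bounded. The gains are monotone, so Q
converges; V + Q converges as well, and a positive limit of V would force V + Q to fall linearly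
forever. No uniform continuity of velocities is needed. Finally V → 0 yields x → 0 and Le → 0, and
Y, Z → 0 yields e → 0. -/

noncomputable section

namespace DistSMC

/-! ### Euclidean norm estimates and the set-valued unit vector -/

section EuclideanNorm

variable {k l : Type*} [Fintype k] [Fintype l]

theorem l2norm_nonneg (w : k → ℝ) : 0 ≤ l2norm w := norm_nonneg _

theorem l2norm_sq (w : k → ℝ) : l2norm w ^ 2 = w ⬝ᵥ w := by
  rw [l2norm, EuclideanSpace.norm_sq_eq]
  simp [dotProduct, sq]

theorem l2norm_zero : l2norm (0 : k → ℝ) = 0 := by simp [l2norm]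

theorem l2norm_eq_zero {w : k → ℝ} : l2norm w = 0 ↔ w = 0 := by simp [l2norm]

theorem l2norm_add_le (w w' : k → ℝ) : l2norm (w + w') ≤ l2norm w + l2norm w' := by
  simpa [l2norm] using norm_add_le (WithLp.toLp 2 w) (WithLp.toLp 2 w')

theorem l2norm_neg (w : k → ℝ) : l2norm (-w) = l2norm w := by simp [l2norm]

theorem l2norm_sub_le (w w' : k → ℝ) : l2norm (w - w') ≤ l2norm w + l2norm w' := by
  simpa [sub_eq_add_neg, l2norm_neg] using l2norm_add_le w (-w')

theorem l2norm_smul (c : ℝ) (w : k → ℝ) : l2norm (c • w) = |c| * l2norm w := by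
  simp [l2norm, norm_smul]

theorem l2norm_sum_le {ι : Type*} (s : Finset ι) (f : ι → k → ℝ) :
    l2norm (∑ i ∈ s, f i) ≤ ∑ i ∈ s, l2norm (f i) := by
  simpa [l2norm, WithLp.toLp_sum] using norm_sum_le s fun i => WithLp.toLp 2 (f i)

theorem abs_dotProduct_le (w w' : k → ℝ) : |w ⬝ᵥ w'| ≤ l2norm w * l2norm w' := by
  have := abs_real_inner_le_norm (WithLp.toLp 2 w) (WithLp.toLp 2 w')
  rwa [EuclideanSpace.inner_toLp_toLp, star_trivial, dotProduct_comm] at this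

theorem dotProduct_le_l2norm (w w' : k → ℝ) : w ⬝ᵥ w' ≤ l2norm w * l2norm w' :=
  (le_abs_self _).trans (abs_dotProduct_le w w')

theorem neg_dotProduct_le_l2norm (w w' : k → ℝ) : -(w ⬝ᵥ w') ≤ l2norm w * l2norm w' :=
  (neg_le_abs _).trans (abs_dotProduct_le w w')

theorem opNorm2_nonneg [DecidableEq l] (M : Matrix k l ℝ) : 0 ≤ opNorm2 M := norm_nonneg _

theorem l2norm_mulVec_le [DecidableEq l] (M : Matrix k l ℝ) (w : l → ℝ) :
    l2norm (M *ᵥ w) ≤ opNorm2 M * l2norm w := by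
  simpa [l2norm, opNorm2] using
    (LinearMap.toContinuousLinearMap (Matrix.toEuclideanLin M)).le_opNorm (WithLp.toLp 2 w)

theorem abs_dotProduct_mulVec_le [DecidableEq l] (M : Matrix k l ℝ) (w : k → ℝ) (w' : l → ℝ) :
    |w ⬝ᵥ M *ᵥ w'| ≤ opNorm2 M * l2norm w * l2norm w' := by
  refine (abs_dotProduct_le _ _).trans ?_
  nlinarith [mul_le_mul_of_nonneg_left (l2norm_mulVec_le M w') (l2norm_nonneg w)]

theorem dotProduct_mulVec_transpose {R : Type*} [CommSemiring R] (M : Matrix k l R)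
    (w : k → R) (w' : l → R) : w ⬝ᵥ M *ᵥ w' = (Mᵀ *ᵥ w) ⬝ᵥ w' := by
  rw [dotProduct_mulVec, mulVec_transpose]

theorem h_dotProduct (ω : k → ℝ) : ω ⬝ᵥ h ω = l2norm ω := by
  by_cases hω : ω = 0
  · simp [hω, l2norm_zero]
  · have : l2norm ω ≠ 0 := fun h0 => hω (l2norm_eq_zero.1 h0)
    simp only [h, hω, if_false, dotProduct_smul, smul_eq_mul, ← l2norm_sq]
    field_simp

/-- At ω = 0 both sides vanish whatever value is selected, so the Lyapunov estimates do not depend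
on the Filippov selection. -/
theorem dotProduct_of_mem_hSet {ω s : k → ℝ} (hs : s ∈ hSet ω) : ω ⬝ᵥ s = l2norm ω := by
  by_cases hω : ω = 0
  · simp [hω, l2norm_zero]
  · rw [hs.1 hω, h_dotProduct]

theorem l2norm_le_one_of_mem_hSet {ω s : k → ℝ} (hs : s ∈ hSet ω) : l2norm s ≤ 1 := by
  by_cases hω : ω = 0
  · exact hs.2 hω
  · have h0 : l2norm ω ≠ 0 := fun h0 => hω (l2norm_eq_zero.1 h0)
    rw [hs.1 hω]
    simp only [h, hω, if_false, l2norm_smul, abs_inv, abs_of_nonneg (l2norm_nonneg ω)]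
    exact (inv_mul_cancel₀ h0).le

end EuclideanNorm

/-! ### Quadratic Lyapunov functions of Hurwitz matrices -/

section Lyapunov

variable {k : Type*} [Fintype k] [DecidableEq k]

open scoped Matrix.Norms.L2Operator in
/-- Powers of a matrix whose complex spectrum lies in the open unit disc become contractive. -/
theorem exists_pow_contractive (C : Matrix k k ℝ)
    (hC : ∀ μ ∈ spectrum ℂ (C.map (algebraMap ℝ ℂ)), ‖μ‖ < 1) :
    ∃ j : ℕ, 1 ≤ j ∧ ∀ w, l2norm ((C ^ j) *ᵥ w) ^ 2 ≤ 1 / 2 * l2norm w ^ 2 := by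
  rcases isEmpty_or_nonempty k with hk | hk
  · refine ⟨1, le_rfl, fun w => ?_⟩
    simp [l2norm_sq, dotProduct]
  set c := C.map (algebraMap ℝ ℂ) with hc
  have hrad : spectralRadius ℂ c < (1 : NNReal) :=
    spectrum.spectralRadius_lt_of_forall_lt c fun μ hμ => by
      have := hC μ hμ
      rwa [← NNReal.coe_lt_coe, coe_nnnorm]
  obtain ⟨ρ, hρ1, hρ2⟩ := ENNReal.lt_iff_exists_nnreal_btwn.1 hrad
  have hρ1' : ρ < 1 := by exact_mod_cast hρ2
  -- Gelfand's formula: ‖c^j‖^(1/j) eventually drops below ρ < 1, so ‖c^j‖ ≤ ρ^j, which is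
  -- eventually below 1/2.
  have hev := (spectrum.pow_nnnorm_pow_one_div_tendsto_nhds_spectralRadius c).eventually_lt_const hρ1
  have hpow : Tendsto (fun j : ℕ => (ρ : ℝ) ^ j) atTop (𝓝 0) :=
    tendsto_pow_atTop_nhds_zero_of_lt_one ρ.2 (by exact_mod_cast hρ1')
  obtain ⟨j, ⟨h1, h2⟩, h3⟩ := ((hev.and (hpow.eventually_lt_const
    (show (0 : ℝ) < 1 / 2 by norm_num))).and (eventually_ge_atTop 1)).exists
  have hj0 : (j : ℝ) ≠ 0 := by positivity
  have hnorm : ‖c ^ j‖ ≤ 1 / 2 := by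
    have h4 : (‖c ^ j‖₊ : ENNReal) ≤ (ρ : ENNReal) ^ j := by
      calc (‖c ^ j‖₊ : ENNReal) = ((‖c ^ j‖₊ : ENNReal) ^ (1 / j : ℝ)) ^ (j : ℝ) := by
            rw [← ENNReal.rpow_mul, one_div_mul_cancel hj0, ENNReal.rpow_one]
        _ ≤ (ρ : ENNReal) ^ (j : ℝ) := ENNReal.rpow_le_rpow h1.le (Nat.cast_nonneg j)
        _ = _ := ENNReal.rpow_natCast _ _
    have h5 : ‖c ^ j‖₊ ≤ ρ ^ j := by exact_mod_cast h4
    have h6 : ‖c ^ j‖ ≤ (ρ : ℝ) ^ j := by exact_mod_cast h5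
    linarith
  refine ⟨j, h3, fun w => ?_⟩
  have hmap : c ^ j = (C ^ j).map (algebraMap ℝ ℂ) := by
    rw [hc]; exact (map_pow (algebraMap ℝ ℂ).mapMatrix C j).symm
  have hvec : ∀ y : k → ℝ, ‖(WithLp.toLp 2 (fun i => (y i : ℂ)) : EuclideanSpace ℂ k)‖
      = l2norm y := by
    intro y
    simp [l2norm, EuclideanSpace.norm_eq]
  have hmul := l2_opNorm_mulVec (c ^ j) (WithLp.toLp 2 (fun i => (w i : ℂ)))
  have hcomm : (c ^ j) *ᵥ (fun i => (w i : ℂ)) = fun i => (((C ^ j) *ᵥ w) i : ℂ) := by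
    ext i
    simp [hmap, mulVec, dotProduct]
  have hle : l2norm ((C ^ j) *ᵥ w) ≤ 1 / 2 * l2norm w := by
    rw [← hvec, ← hvec, ← hcomm]
    exact hmul.trans (mul_le_mul_of_nonneg_right hnorm (norm_nonneg _))
  nlinarith [l2norm_nonneg ((C ^ j) *ᵥ w), l2norm_nonneg w]

/-- The Cayley transform maps Hurwitz matrices to matrices with spectrum in the unit disc. -/
theorem norm_lt_one_of_mem_spectrum_cayley {E M : Matrix k k ℂ}
    (hE : ∀ μ ∈ spectrum ℂ E, μ.re < 0) (h1 : (1 - E) * M = 1) {μ : ℂ}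
    (hμ : μ ∈ spectrum ℂ ((1 + E) * M)) : ‖μ‖ < 1 := by
  by_contra! hge
  refine hμ ?_
  have h2 : M * (1 - E) = 1 := mul_eq_one_comm.1 h1
  have hM : IsUnit M := ⟨⟨M, 1 - E, h2, h1⟩, rfl⟩
  have hfac : algebraMap ℂ (Matrix k k ℂ) μ - (1 + E) * M
      = (algebraMap ℂ (Matrix k k ℂ) μ * (1 - E) - (1 + E)) * M := by
    rw [sub_mul, mul_assoc, h1, mul_one]
  rw [spectrum.mem_resolventSet_iff, hfac]
  refine IsUnit.mul ?_ hM
  -- The Möbius preimage (μ - 1)/(μ + 1) is undefined at μ = -1; there the factor is the invertible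
  -- scalar -2.
  by_cases hm : μ = -1
  · have : algebraMap ℂ (Matrix k k ℂ) μ * (1 - E) - (1 + E) = algebraMap ℂ _ (-2) := by
      rw [hm, map_neg, map_neg, map_one, show (2 : ℂ) = 1 + 1 by norm_num, map_add, map_one]
      noncomm_ring
    rw [this]
    exact (IsUnit.mk0 (-2 : ℂ) (by norm_num)).map _
  · have hm' : μ + 1 ≠ 0 := fun h0 => hm (eq_neg_of_add_eq_zero_left h0)
    -- The real part of this number is (|μ|² - 1)/|μ + 1|², which is nonnegative when |μ| ≥ 1.
    have hν : (μ - 1) / (μ + 1) ∉ spectrum ℂ E := by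
      intro hmem
      have hre := hE _ hmem
      have hpos : 0 < Complex.normSq (μ + 1) := Complex.normSq_pos.2 hm'
      have hsq : 1 ≤ μ.re ^ 2 + μ.im ^ 2 := by
        have : ‖μ‖ ^ 2 = μ.re ^ 2 + μ.im ^ 2 := by
          rw [Complex.sq_norm, Complex.normSq_apply]; ring
        nlinarith
      rw [Complex.div_re, ← add_div, div_lt_iff₀ hpos] at hre
      simp at hre
      nlinarith
    rw [spectrum.mem_iff, not_not] at hν
    have heq : algebraMap ℂ (Matrix k k ℂ) μ * (1 - E) - (1 + E)
        = algebraMap ℂ (Matrix k k ℂ) (μ + 1)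
          * (algebraMap ℂ (Matrix k k ℂ) ((μ - 1) / (μ + 1)) - E) := by
      rw [mul_sub (algebraMap ℂ (Matrix k k ℂ) (μ + 1)), ← map_mul, mul_div_cancel₀ _ hm',
        map_sub, map_add, map_one]
      noncomm_ring
    rw [heq]
    exact ((IsUnit.mk0 _ hm').map _).mul hν

/-- **Lyapunov's theorem**: a Hurwitz matrix admits a quadratic Lyapunov function. -/
theorem IsHurwitz.exists_lyapunov {E : Matrix k k ℝ} (hE : IsHurwitz E) :
    ∃ R : Matrix k k ℝ, Rᵀ = R ∧ (∀ y, l2norm y ^ 2 ≤ y ⬝ᵥ R *ᵥ y) ∧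
      ∃ c : ℝ, 0 < c ∧ ∀ y, 2 * (y ⬝ᵥ R *ᵥ (E *ᵥ y)) ≤ -c * l2norm y ^ 2 := by
  have hunit : IsUnit (1 - E) := by
    rw [isUnit_iff_isUnit_det]
    have h1 : (1 : ℂ) ∉ spectrum ℂ (E.map (algebraMap ℝ ℂ)) := fun hmem => by
      have := hE 1 hmem; norm_num at this
    rw [spectrum.mem_iff, not_not, map_one, isUnit_iff_isUnit_det] at h1
    have h2 : (1 : Matrix k k ℂ) - E.map (algebraMap ℝ ℂ)
        = (algebraMap ℝ ℂ).mapMatrix (1 - E) := by rw [map_sub, map_one]; rfl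
    rw [h2, ← RingHom.map_det] at h1
    rw [isUnit_iff_ne_zero] at h1 ⊢
    exact fun h0 => h1 (by rw [h0, map_zero])
  obtain ⟨M, hM1⟩ := hunit.exists_right_inv
  have hM2 : M * (1 - E) = 1 := mul_eq_one_comm.1 hM1
  obtain ⟨j, hj, hcon⟩ := exists_pow_contractive ((1 + E) * M) fun μ hμ => by
    refine norm_lt_one_of_mem_spectrum_cayley hE
      (M := M.map (algebraMap ℝ ℂ)) ?_ (μ := μ) ?_
    · have := congrArg (algebraMap ℝ ℂ).mapMatrix hM1
      rw [map_mul, map_sub, map_one] at this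
      exact this
    · have h3 : ((1 + E) * M).map (algebraMap ℝ ℂ)
          = (algebraMap ℝ ℂ).mapMatrix ((1 + E) * M) := rfl
      rw [h3, map_mul, map_add, map_one] at hμ
      exact hμ
  set C := (1 + E) * M with hCdef
  have hquad : ∀ y w, y ⬝ᵥ (∑ i ∈ Finset.range j, (C ^ i)ᵀ * C ^ i) *ᵥ w
      = ∑ i ∈ Finset.range j, ((C ^ i) *ᵥ y) ⬝ᵥ ((C ^ i) *ᵥ w) := by
    intro y w
    rw [Matrix.sum_mulVec, dotProduct_sum]
    refine Finset.sum_congr rfl fun i _ => ?_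
    rw [← mulVec_mulVec, dotProduct_mulVec_transpose, transpose_transpose]
  -- A finite Stein-type sum replaces the usual integral of matrix exponentials; the contractive
  -- power C^j makes truncation at j harmless. The term i = 0 gives R ≥ I.
  set R := ∑ i ∈ Finset.range j, (C ^ i)ᵀ * C ^ i with hR
  have hsymm : Rᵀ = R := by
    rw [hR, transpose_sum]
    exact Finset.sum_congr rfl fun i _ => by rw [transpose_mul, transpose_transpose]
  refine ⟨R, hsymm, fun y => ?_, ?_⟩
  · rw [hquad]
    have := Finset.single_le_sum (f := fun i => ((C ^ i) *ᵥ y) ⬝ᵥ ((C ^ i) *ᵥ y))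
      (fun i _ => by rw [← l2norm_sq]; positivity) (Finset.mem_range.2 hj)
    simpa [l2norm_sq] using this
  · have hstep : ∀ w, (C *ᵥ w) ⬝ᵥ R *ᵥ (C *ᵥ w) - w ⬝ᵥ R *ᵥ w ≤ -(1 / 2) * l2norm w ^ 2 := by
      intro w
      rw [hquad, hquad]
      have h4 : ∀ i, ((C ^ i) *ᵥ (C *ᵥ w)) ⬝ᵥ ((C ^ i) *ᵥ (C *ᵥ w))
          = l2norm ((C ^ (i + 1)) *ᵥ w) ^ 2 := fun i => by
        rw [mulVec_mulVec, ← pow_succ, l2norm_sq]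
      simp only [h4]
      simp only [← l2norm_sq]
      rw [← Finset.sum_sub_distrib,
        Finset.sum_range_sub (fun i => l2norm ((C ^ i) *ᵥ w) ^ 2)]
      have := hcon w
      simp only [pow_zero, one_mulVec]
      linarith
    -- With w = (1 - E)y one has Cw = (1 + E)y, and the difference of the two quadratic forms
    -- polarizes to 4 yᵀREy: discrete decay becomes continuous decay.
    have hcay : ∀ y, 4 * (y ⬝ᵥ R *ᵥ (E *ᵥ y)) ≤ -(1 / 2) * l2norm ((1 - E) *ᵥ y) ^ 2 := by
      intro y
      have h5 := hstep ((1 - E) *ᵥ y)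
      have h6 : C *ᵥ ((1 - E) *ᵥ y) = (1 + E) *ᵥ y := by
        rw [mulVec_mulVec, hCdef, mul_assoc, hM2, mul_one]
      have h7 : (E *ᵥ y) ⬝ᵥ R *ᵥ y = y ⬝ᵥ R *ᵥ (E *ᵥ y) := by
        rw [dotProduct_mulVec_transpose, hsymm, dotProduct_comm]
      rw [h6] at h5
      simp only [add_mulVec, sub_mulVec, one_mulVec, mulVec_add, mulVec_sub, add_dotProduct,
        dotProduct_add, sub_dotProduct, dotProduct_sub] at h5 ⊢
      linarith
    have hinv : ∀ y, l2norm y ≤ (opNorm2 M + 1) * l2norm ((1 - E) *ᵥ y) := by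
      intro y
      have h8 := l2norm_mulVec_le M ((1 - E) *ᵥ y)
      rw [mulVec_mulVec, hM2, one_mulVec] at h8
      linarith [l2norm_nonneg ((1 - E) *ᵥ y)]
    have hpos : 0 < opNorm2 M + 1 := by linarith [opNorm2_nonneg M]
    refine ⟨1 / (4 * (opNorm2 M + 1) ^ 2), by positivity, fun y => ?_⟩
    have h9 : l2norm y ^ 2 ≤ (opNorm2 M + 1) ^ 2 * l2norm ((1 - E) *ᵥ y) ^ 2 := by
      rw [← mul_pow]
      exact pow_le_pow_left₀ (l2norm_nonneg y) (hinv y) 2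
    have h10 : 1 / (4 * (opNorm2 M + 1) ^ 2) * l2norm y ^ 2
        ≤ 1 / 4 * l2norm ((1 - E) *ᵥ y) ^ 2 := by
      rw [div_mul_eq_mul_div, div_le_iff₀ (by positivity)]
      linarith
    linarith [hcay y]

end Lyapunov

/-! ### Local absolute continuity and derivatives of quadratic expressions -/

section Calculus

/-- Local absolute continuity on `[0, ∞)`. -/
def LocAC (f : ℝ → ℝ) : Prop := ∀ T, 0 ≤ T → AbsolutelyContinuousOnInterval f 0 T

/-- Coordinatewise local absolute continuity on `[0, ∞)`. -/
def VecLocAC {k : Type*} (f : ℝ → k → ℝ) : Prop := ∀ j, LocAC fun t => f t j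

theorem LocAC.add {f g : ℝ → ℝ} (hf : LocAC f) (hg : LocAC g) : LocAC fun t => f t + g t :=
  fun T hT => (hf T hT).add (hg T hT)

theorem LocAC.sub {f g : ℝ → ℝ} (hf : LocAC f) (hg : LocAC g) : LocAC fun t => f t - g t :=
  fun T hT => (hf T hT).sub (hg T hT)

theorem LocAC.mul {f g : ℝ → ℝ} (hf : LocAC f) (hg : LocAC g) : LocAC fun t => f t * g t :=
  fun T hT => (hf T hT).mul (hg T hT)

theorem LocAC.const_mul {f : ℝ → ℝ} (c : ℝ) (hf : LocAC f) : LocAC fun t => c * f t :=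
  fun T hT => (hf T hT).const_mul c

theorem LocAC.of_contDiff {f : ℝ → ℝ} (hf : ContDiff ℝ 1 f) : LocAC f :=
  fun _ _ => hf.contDiffOn.absolutelyContinuousOnInterval

theorem LocAC.const (c : ℝ) : LocAC fun _ => c := LocAC.of_contDiff contDiff_const

theorem LocAC.sum {ι : Type*} (s : Finset ι) {f : ι → ℝ → ℝ} (hf : ∀ i ∈ s, LocAC (f i)) :
    LocAC fun t => ∑ i ∈ s, f i t := by
  classical
  induction s using Finset.induction_on with
  | empty => simpa using LocAC.const 0
  | insert i s hi ih =>
    simp only [Finset.sum_insert hi]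
    exact (hf i (Finset.mem_insert_self i s)).add
      (ih fun j hj => hf j (Finset.mem_insert_of_mem hj))

theorem VecLocAC.of_absolutelyContinuousOnInterval {k : Type*} [Fintype k] {f : ℝ → k → ℝ}
    (hf : ∀ T, 0 ≤ T → AbsolutelyContinuousOnInterval f 0 T) : VecLocAC f := by
  intro j T hT
  have h1 := hf T hT
  unfold AbsolutelyContinuousOnInterval at h1 ⊢
  refine squeeze_zero (fun _ => Finset.sum_nonneg fun _ _ => dist_nonneg) (fun I => ?_) h1
  exact Finset.sum_le_sum fun i _ => dist_le_pi_dist (f _) (f _) j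

section Vector

variable {k l : Type*}

theorem VecLocAC.add {f g : ℝ → k → ℝ} (hf : VecLocAC f) (hg : VecLocAC g) :
    VecLocAC fun t => f t + g t := fun j => (hf j).add (hg j)

theorem VecLocAC.sub {f g : ℝ → k → ℝ} (hf : VecLocAC f) (hg : VecLocAC g) :
    VecLocAC fun t => f t - g t := fun j => (hf j).sub (hg j)

theorem VecLocAC.const_smul {f : ℝ → k → ℝ} (c : ℝ) (hf : VecLocAC f) :
    VecLocAC fun t => c • f t := fun j => (hf j).const_mul c

theorem VecLocAC.sum {ι : Type*} (s : Finset ι) {f : ι → ℝ → k → ℝ}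
    (hf : ∀ i ∈ s, VecLocAC (f i)) : VecLocAC fun t => ∑ i ∈ s, f i t := by
  intro j
  simp only [Finset.sum_apply]
  exact LocAC.sum s fun i hi => hf i hi j

variable [Fintype l]

theorem VecLocAC.mulVec (M : Matrix k l ℝ) {f : ℝ → l → ℝ} (hf : VecLocAC f) :
    VecLocAC fun t => M *ᵥ f t := fun _ => LocAC.sum _ fun j _ => (hf j).const_mul _

theorem hasDerivAt_mulVec (M : Matrix k l ℝ) {f : ℝ → l → ℝ} {f' : l → ℝ} {t : ℝ}
    (hf : HasDerivAt f f' t) : HasDerivAt (fun s => M *ᵥ f s) (M *ᵥ f') t := by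
  rw [hasDerivAt_pi] at hf ⊢
  exact fun i => HasDerivAt.fun_sum fun j _ => (hf j).const_mul _

variable [Fintype k]

theorem VecLocAC.dotProduct {f g : ℝ → k → ℝ} (hf : VecLocAC f) (hg : VecLocAC g) :
    LocAC fun t => f t ⬝ᵥ g t := LocAC.sum _ fun j _ => (hf j).mul (hg j)

theorem hasDerivAt_dotProduct {f g : ℝ → k → ℝ} {f' g' : k → ℝ} {t : ℝ}
    (hf : HasDerivAt f f' t) (hg : HasDerivAt g g' t) :
    HasDerivAt (fun s => f s ⬝ᵥ g s) (f' ⬝ᵥ g t + f t ⬝ᵥ g') t := by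
  rw [hasDerivAt_pi] at hf hg
  simp only [_root_.dotProduct, ← Finset.sum_add_distrib]
  exact HasDerivAt.fun_sum fun j _ => (hf j).mul (hg j)

/-- Derivative of a symmetric quadratic form along a curve. -/
theorem hasDerivAt_quadratic {R : Matrix k k ℝ} (hR : Rᵀ = R) {f : ℝ → k → ℝ} {f' : k → ℝ}
    {t : ℝ} (hf : HasDerivAt f f' t) :
    HasDerivAt (fun s => f s ⬝ᵥ R *ᵥ f s) (2 * (f t ⬝ᵥ R *ᵥ f')) t := by
  have h1 := hasDerivAt_dotProduct hf (hasDerivAt_mulVec R hf)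
  have h2 : f' ⬝ᵥ R *ᵥ f t = f t ⬝ᵥ R *ᵥ f' := by
    rw [dotProduct_mulVec_transpose, hR, dotProduct_comm]
  rw [h2, ← two_mul] at h1
  exact h1

end Vector

/-! ### Integration of differential inequalities valid almost everywhere -/

/-- A locally absolutely continuous function whose derivative is almost everywhere nonpositive
on `(T, ∞)` is antitone on `[T, ∞)`. -/
theorem LocAC.antitoneOn {f : ℝ → ℝ} (hf : LocAC f) {T : ℝ} (hT : 0 ≤ T)
    (hd : ∀ᵐ t ∂(volume.restrict (Set.Ioi (0 : ℝ))), T < t → ∃ d ≤ 0, HasDerivAt f d t) :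
    AntitoneOn f (Set.Ici T) := by
  intro r hr s hs hrs
  have hr' : T ≤ r := hr
  have hac : AbsolutelyContinuousOnInterval f r s :=
    (hf s (hT.trans (hr'.trans hrs))).mono (by
      rw [Set.uIcc_of_le hrs, Set.uIcc_of_le (hT.trans (hr'.trans hrs))]
      exact Set.Icc_subset_Icc_left (hT.trans hr'))
  have hint := hac.integral_deriv_eq_sub
  have hnonpos : ∫ t in r..s, deriv f t ≤ 0 := by
    rw [intervalIntegral.integral_of_le hrs]
    refine setIntegral_nonpos_of_ae_restrict ?_
    have hsub : Set.Ioc r s ⊆ Set.Ioi 0 := fun t ht => lt_of_le_of_lt (hT.trans hr') ht.1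
    filter_upwards [ae_restrict_of_ae_restrict_of_subset hsub hd,
      ae_restrict_mem measurableSet_Ioc] with t ht htm
    obtain ⟨d, hd0, hd1⟩ := ht (lt_of_le_of_lt hr' htm.1)
    simpa [hd1.deriv] using hd0
  linarith

theorem LocAC.monotoneOn {f : ℝ → ℝ} (hf : LocAC f)
    (hd : ∀ᵐ t ∂(volume.restrict (Set.Ioi (0 : ℝ))), ∃ d ≥ 0, HasDerivAt f d t) :
    MonotoneOn f (Set.Ici 0) := by
  have h1 := (hf.const_mul (-1)).antitoneOn le_rfl (by
    filter_upwards [hd] with t ⟨d, hd0, hd1⟩ _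
    exact ⟨-1 * d, by linarith, hd1.const_mul (-1)⟩)
  intro r hr s hs hrs
  have := h1 hr hs hrs
  simp only at this
  linarith

theorem exists_tendsto_of_monotoneOn {f : ℝ → ℝ} (hf : MonotoneOn f (Set.Ici 0)) {M : ℝ}
    (hM : ∀ t, 0 ≤ t → f t ≤ M) : ∃ L, Tendsto f atTop (𝓝 L) := by
  have hmono : Monotone fun t => f (max t 0) := fun r s hrs =>
    hf (le_max_right r 0) (le_max_right s 0) (max_le_max_right 0 hrs)
  refine ⟨_, (tendsto_atTop_ciSup hmono ⟨M, ?_⟩).congr' ?_⟩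
  · rintro _ ⟨t, rfl⟩
    exact hM _ (le_max_right t 0)
  · filter_upwards [eventually_ge_atTop 0] with t ht
    rw [max_eq_left ht]

theorem exists_tendsto_of_antitoneOn {f : ℝ → ℝ} (hf : AntitoneOn f (Set.Ici 0)) {m : ℝ}
    (hm : ∀ t, 0 ≤ t → m ≤ f t) : ∃ L, Tendsto f atTop (𝓝 L) := by
  obtain ⟨L, hL⟩ := exists_tendsto_of_monotoneOn (f := fun t => -f t) hf.neg (M := -m)
    fun t ht => neg_le_neg (hm t ht)
  exact ⟨-L, by simpa using hL.neg⟩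

theorem hasDerivAt_const_mul_exp (a c t : ℝ) :
    HasDerivAt (fun s => a * Real.exp (c * s)) (a * (c * Real.exp (c * t))) t := by
  have h1 : HasDerivAt (fun s : ℝ => c * s) c t := by simpa using (hasDerivAt_id t).const_mul c
  simpa [mul_comm] using h1.exp.const_mul a

theorem LocAC.const_mul_exp (a c : ℝ) : LocAC fun s => a * Real.exp (c * s) :=
  LocAC.of_contDiff (by fun_prop)

theorem tendsto_const_mul_exp_neg (a : ℝ) {c : ℝ} (hc : 0 < c) :
    Tendsto (fun s => a * Real.exp (-c * s)) atTop (𝓝 0) := by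
  have h1 : Tendsto (fun s : ℝ => -c * s) atTop atBot :=
    tendsto_id.const_mul_atTop_of_neg (by linarith)
  simpa using (Real.tendsto_exp_atBot.comp h1).const_mul a

/-- Exponential decay from a linear differential inequality. -/
theorem LocAC.le_exp {f : ℝ → ℝ} (hf : LocAC f) {c : ℝ}
    (hd : ∀ᵐ t ∂(volume.restrict (Set.Ioi (0 : ℝ))), ∃ d ≤ -c * f t, HasDerivAt f d t) :
    ∀ t, 0 ≤ t → f t ≤ f 0 * Real.exp (-c * t) := by
  have h1 := (hf.mul (LocAC.const_mul_exp 1 c)).antitoneOn le_rfl (by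
    filter_upwards [hd] with t ⟨d, hd0, hd1⟩ _
    refine ⟨_, ?_, hd1.mul (hasDerivAt_const_mul_exp 1 c t)⟩
    nlinarith [mul_le_mul_of_nonneg_right hd0 (Real.exp_pos (c * t)).le])
  intro t ht
  have h2 := h1 (Set.mem_Ici.2 le_rfl) (Set.mem_Ici.2 ht) ht
  simp only [mul_zero, Real.exp_zero, mul_one, one_mul] at h2
  have h3 := mul_le_mul_of_nonneg_right h2 (Real.exp_pos (-c * t)).le
  rwa [mul_assoc, ← Real.exp_add, show c * t + -c * t = 0 by ring, Real.exp_zero, mul_one] at h3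

/-- Boundedness from a differential inequality with an exponentially decaying perturbation. -/
theorem LocAC.bounded_of_perturbed {V Q : ℝ → ℝ} (hW : LocAC fun t => V t + Q t)
    (hV : ∀ t, 0 ≤ V t) {κ C c : ℝ} (hκ : 0 < κ) (hC : 0 ≤ C) (hc : 0 < c)
    (hd : ∀ᵐ t ∂(volume.restrict (Set.Ioi (0 : ℝ))),
      ∃ d ≤ -κ * V t + C * Real.exp (-c * t), HasDerivAt (fun t => V t + Q t) d t) :
    AntitoneOn (fun t => V t + Q t + C / c * Real.exp (-c * t)) (Set.Ici 0) ∧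
      ∀ t, 0 ≤ t → V t + Q t ≤ V 0 + Q 0 + C / c := by
  -- The added term is the tail integral of the perturbation; its derivative cancels C e^{-ct}.
  have h1 := (hW.add (LocAC.const_mul_exp (C / c) (-c))).antitoneOn le_rfl (by
    filter_upwards [hd] with t ⟨d, hd0, hd1⟩ _
    refine ⟨_, ?_, hd1.add (hasDerivAt_const_mul_exp (C / c) (-c) t)⟩
    have : C / c * (-c * Real.exp (-c * t)) = -(C * Real.exp (-c * t)) := by field_simp
    rw [this]
    nlinarith [hV t])
  refine ⟨h1, fun t ht => ?_⟩
  have h2 := h1 (Set.mem_Ici.2 le_rfl) (Set.mem_Ici.2 ht) ht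
  have h3 : 0 ≤ C / c * Real.exp (-c * t) := by positivity
  simp at h2
  rw [neg_mul] at h3
  linarith

/-- If `V + Q` decreases at rate at least `κ V` up to an exponentially decaying perturbation and
`Q ≥ 0` converges, then `V` tends to zero. -/
theorem LocAC.tendsto_zero_of_perturbed {V Q : ℝ → ℝ} (hW : LocAC fun t => V t + Q t)
    (hV : ∀ t, 0 ≤ V t) (hQ : ∀ t, 0 ≤ Q t) {κ C c L : ℝ} (hκ : 0 < κ) (hC : 0 ≤ C)
    (hc : 0 < c)
    (hd : ∀ᵐ t ∂(volume.restrict (Set.Ioi (0 : ℝ))),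
      ∃ d ≤ -κ * V t + C * Real.exp (-c * t), HasDerivAt (fun t => V t + Q t) d t)
    (hL : Tendsto Q atTop (𝓝 L)) : Tendsto V atTop (𝓝 0) := by
  have hanti := (hW.bounded_of_perturbed hV hκ hC hc hd).1
  have hexp0 : ∀ t, 0 ≤ C / c * Real.exp (-c * t) := fun t => by positivity
  obtain ⟨l, hl⟩ := exists_tendsto_of_antitoneOn hanti (m := 0) fun t _ => by
    exact add_nonneg (add_nonneg (hV t) (hQ t)) (hexp0 t)
  have hVl : Tendsto V atTop (𝓝 (l - 0 - L)) := by
    refine ((hl.sub (tendsto_const_mul_exp_neg (C / c) hc)).sub hL).congr fun t => ?_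
    ring
  rw [sub_zero] at hVl
  have hl0 : 0 ≤ l - L := ge_of_tendsto' hVl hV
  rcases hl0.eq_or_lt with h0 | hpos
  · rwa [← h0] at hVl
  · exfalso
    obtain ⟨T, hT0, hT⟩ : ∃ T, 0 ≤ T ∧ ∀ t, T ≤ t → (l - L) / 2 ≤ V t := by
      obtain ⟨T, hT⟩ := eventually_atTop.1
        (hVl.eventually_const_le (show (l - L) / 2 < l - L by linarith))
      exact ⟨max T 0, le_max_right _ _, fun t ht => hT t ((le_max_left _ _).trans ht)⟩
    -- While V ≥ (l - L)/2, adding this linear term keeps the corrected V + Q nonincreasing. The sum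
    -- would nevertheless tend to infinity, its other terms being nonnegative.
    have hlin : LocAC fun t : ℝ => κ * ((l - L) / 2) * t := LocAC.of_contDiff (by fun_prop)
    have h1 := ((hW.add (LocAC.const_mul_exp (C / c) (-c))).add hlin).antitoneOn hT0 (by
      filter_upwards [hd] with t ⟨d, hd0, hd1⟩ htT
      refine ⟨_, ?_, (hd1.add (hasDerivAt_const_mul_exp (C / c) (-c) t)).add
        ((hasDerivAt_id t).const_mul (κ * ((l - L) / 2)))⟩
      have h2 : C / c * (-c * Real.exp (-c * t)) = -(C * Real.exp (-c * t)) := by field_simp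
      rw [h2]
      nlinarith [mul_le_mul_of_nonneg_left (hT t htT.le) hκ.le])
    have htop : Tendsto (fun t : ℝ => κ * ((l - L) / 2) * t) atTop atTop :=
      tendsto_id.const_mul_atTop (by positivity)
    obtain ⟨t, htb, htT⟩ := ((htop.eventually_gt_atTop
      (V T + Q T + C / c * Real.exp (-c * T) + κ * ((l - L) / 2) * T)).and
        (eventually_ge_atTop T)).exists
    have h3 := h1 (Set.mem_Ici.2 le_rfl) (Set.mem_Ici.2 htT) htT
    have := hexp0 t; have := hV t; have := hQ t
    simp only at h3
    linarith

end Calculus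

/-- The constant is the minimum of the form on the compact unit sphere; homogeneity does the rest.
-/
theorem exists_pos_quadratic_lower_bound {k : Type*} [Fintype k] {Q : Matrix k k ℝ}
    (hQ : Q.PosDef) : ∃ c : ℝ, 0 < c ∧ ∀ y, c * l2norm y ^ 2 ≤ y ⬝ᵥ Q *ᵥ y := by
  classical
  have hpos : ∀ y, y ≠ 0 → 0 < y ⬝ᵥ Q *ᵥ y := fun y hy => by
    simpa using hQ.dotProduct_mulVec_pos hy
  rcases isEmpty_or_nonempty k with hk | hk
  · exact ⟨1, one_pos, fun y => by simp [l2norm_sq, dotProduct]⟩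
  have hcont : Continuous fun y : EuclideanSpace ℝ k => y.ofLp ⬝ᵥ Q *ᵥ y.ofLp := by
    unfold dotProduct mulVec dotProduct
    fun_prop
  obtain ⟨y₀, hy₀, hmin⟩ := (isCompact_sphere (0 : EuclideanSpace ℝ k) 1).exists_isMinOn
    (NormedSpace.sphere_nonempty.2 zero_le_one) hcont.continuousOn
  have hy₀' : y₀.ofLp ≠ 0 := fun h0 => by
    have : y₀ = 0 := by ext i; simp [h0]
    simp [this] at hy₀
  refine ⟨_, hpos _ hy₀', fun y => ?_⟩
  by_cases hy : y = 0
  · simp [hy, l2norm_zero]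
  · have hn : 0 < l2norm y := lt_of_le_of_ne (l2norm_nonneg y)
      fun h0 => hy (l2norm_eq_zero.1 h0.symm)
    have h1 := hmin (a := WithLp.toLp 2 ((l2norm y)⁻¹ • y)) (by
      have : ‖(WithLp.toLp 2 ((l2norm y)⁻¹ • y) : EuclideanSpace ℝ k)‖ = 1 := by
        change l2norm ((l2norm y)⁻¹ • y) = 1
        rw [l2norm_smul, abs_of_pos (inv_pos.2 hn), inv_mul_cancel₀ hn.ne']
      simpa using this)
    simp only [Set.mem_ofPred_eq, mulVec_smul, smul_dotProduct, dotProduct_smul, smul_eq_mul] at h1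
    calc _ ≤ ((l2norm y)⁻¹ * ((l2norm y)⁻¹ * (y ⬝ᵥ Q *ᵥ y))) * l2norm y ^ 2 :=
          mul_le_mul_of_nonneg_right h1 (by positivity)
      _ = _ := by field_simp

theorem exists_uniform_bound {ι : Type*} [Finite ι] (f : ι → ℝ) :
    ∃ c : ℝ, 0 ≤ c ∧ ∀ i, f i ≤ c := by
  obtain ⟨c, hc⟩ := Set.Finite.bddAbove (Set.finite_range f)
  exact ⟨max c 0, le_max_right _ _, fun i => (hc ⟨i, rfl⟩).trans (le_max_left _ _)⟩

/-! ### The weighted graph Laplacian -/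

section Laplacian

variable {ι k : Type*} [Fintype ι]

/-- The weighted graph Laplacian acting on vector-valued node signals. -/
def lap (a : Matrix ι ι ℝ) (e : ι → k → ℝ) (i : ι) : k → ℝ := ∑ j, a i j • (e i - e j)

theorem lap_add (a : Matrix ι ι ℝ) (e f : ι → k → ℝ) (i : ι) :
    lap a (e + f) i = lap a e i + lap a f i := by
  simp only [lap, ← Finset.sum_add_distrib, ← smul_add, Pi.add_apply]
  exact Finset.sum_congr rfl fun j _ => by rw [add_sub_add_comm]

theorem lap_smul (a : Matrix ι ι ℝ) (c : ℝ) (e : ι → k → ℝ) (i : ι) :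
    lap a (c • e) i = c • lap a e i := by
  simp only [lap, Finset.smul_sum, Pi.smul_apply, ← smul_sub]
  exact Finset.sum_congr rfl fun j _ => smul_comm _ _ _

variable [Fintype k]

/-- Summation by parts: exchanging the two node indices and averaging uses the symmetry of the
weights. -/
theorem sum_dotProduct_lap {a : Matrix ι ι ℝ} (ha : ∀ i j, a i j = a j i) (e f : ι → k → ℝ) :
    ∑ i, f i ⬝ᵥ lap a e i = 1 / 2 * ∑ i, ∑ j, a i j * ((f i - f j) ⬝ᵥ (e i - e j)) := by
  have h1 : ∑ i, f i ⬝ᵥ lap a e i = ∑ i, ∑ j, a i j * (f i ⬝ᵥ (e i - e j)) := by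
    simp only [lap, dotProduct_sum, dotProduct_smul, smul_eq_mul]
  have h2 : ∑ i, ∑ j, a i j * (f i ⬝ᵥ (e i - e j))
      = ∑ i, ∑ j, -(a i j * (f j ⬝ᵥ (e i - e j))) := by
    rw [Finset.sum_comm]
    refine Finset.sum_congr rfl fun i _ => Finset.sum_congr rfl fun j _ => ?_
    rw [ha j i, ← neg_sub (e i) (e j), dotProduct_neg, mul_neg]
  have h3 : ∑ i, ∑ j, a i j * ((f i - f j) ⬝ᵥ (e i - e j))
      = ∑ i, ∑ j, a i j * (f i ⬝ᵥ (e i - e j)) + ∑ i, ∑ j, -(a i j * (f j ⬝ᵥ (e i - e j))) := by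
    simp only [← Finset.sum_add_distrib]
    refine Finset.sum_congr rfl fun i _ => Finset.sum_congr rfl fun j _ => ?_
    rw [sub_dotProduct]
    ring
  rw [h3, ← h2, h1]
  ring

theorem sum_dotProduct_lap_comm {a : Matrix ι ι ℝ} (ha : ∀ i j, a i j = a j i)
    (e f : ι → k → ℝ) : ∑ i, f i ⬝ᵥ lap a e i = ∑ i, e i ⬝ᵥ lap a f i := by
  rw [sum_dotProduct_lap ha, sum_dotProduct_lap ha]
  simp only [dotProduct_comm]

theorem sum_dotProduct_lap_self {a : Matrix ι ι ℝ} (ha : ∀ i j, a i j = a j i)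
    (e : ι → k → ℝ) :
    ∑ i, e i ⬝ᵥ lap a e i = 1 / 2 * ∑ i, ∑ j, a i j * l2norm (e i - e j) ^ 2 := by
  simp only [sum_dotProduct_lap ha, l2norm_sq]

theorem sum_dotProduct_lap_nonneg {a : Matrix ι ι ℝ} (ha : ∀ i j, a i j = a j i)
    (ha0 : ∀ i j, 0 ≤ a i j) (e : ι → k → ℝ) : 0 ≤ ∑ i, e i ⬝ᵥ lap a e i := by
  rw [sum_dotProduct_lap_self ha]
  exact mul_nonneg (by norm_num) (Finset.sum_nonneg fun i _ => Finset.sum_nonneg fun j _ =>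
    mul_nonneg (ha0 i j) (sq_nonneg _))

theorem weight_mul_sq_le {a : Matrix ι ι ℝ} (ha : ∀ i j, a i j = a j i)
    (ha0 : ∀ i j, 0 ≤ a i j) (e : ι → k → ℝ) (i j : ι) :
    a i j * l2norm (e i - e j) ^ 2 ≤ 2 * ∑ i, e i ⬝ᵥ lap a e i := by
  rw [sum_dotProduct_lap_self ha]
  have h1 := Finset.single_le_sum (f := fun j => a i j * l2norm (e i - e j) ^ 2)
    (fun j _ => mul_nonneg (ha0 i j) (sq_nonneg _)) (Finset.mem_univ j)
  have h2 := Finset.single_le_sum (f := fun i => ∑ j, a i j * l2norm (e i - e j) ^ 2)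
    (fun i _ => Finset.sum_nonneg fun j _ => mul_nonneg (ha0 i j) (sq_nonneg _))
    (Finset.mem_univ i)
  calc a i j * l2norm (e i - e j) ^ 2 ≤ ∑ j, a i j * l2norm (e i - e j) ^ 2 := h1
    _ ≤ ∑ i, ∑ j, a i j * l2norm (e i - e j) ^ 2 := h2
    _ = _ := by ring

theorem exists_lap_le (a : Matrix ι ι ℝ) : ∃ c : ℝ, 0 ≤ c ∧ ∀ (e : ι → k → ℝ) (s : ℝ),
    (∀ j, l2norm (e j) ≤ s) → ∀ i, l2norm (lap a e i) ≤ c * s := by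
  obtain ⟨c, hc0, hc⟩ := exists_uniform_bound fun i => ∑ j, |a i j| * 2
  refine ⟨c, hc0, fun e s hs i => ?_⟩
  have hs0 : 0 ≤ s := (l2norm_nonneg (e i)).trans (hs i)
  refine (l2norm_sum_le _ _).trans (le_trans ?_ (mul_le_mul_of_nonneg_right (hc i) hs0))
  rw [Finset.sum_mul]
  refine Finset.sum_le_sum fun j _ => ?_
  rw [l2norm_smul, mul_assoc]
  refine mul_le_mul_of_nonneg_left ?_ (abs_nonneg _)
  linarith [l2norm_sub_le (e i) (e j), hs i, hs j]

/-- Cauchy–Schwarz over the neighbours, each weighted edge difference being bounded by the quadratic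
form. Thus the energy controls Le, although it vanishes on nonzero consensus errors and so cannot
control e. -/
theorem exists_lap_sq_le {a : Matrix ι ι ℝ} (ha : ∀ i j, a i j = a j i)
    (ha0 : ∀ i j, 0 ≤ a i j) : ∃ c : ℝ, 0 ≤ c ∧ ∀ (e : ι → k → ℝ) (i : ι),
    l2norm (lap a e i) ^ 2 ≤ c * ∑ i, e i ⬝ᵥ lap a e i := by
  obtain ⟨c, hc0, hc⟩ := exists_uniform_bound fun i => Fintype.card ι * ∑ j, a i j * 2
  refine ⟨c, hc0, fun e i => ?_⟩
  have hnn := sum_dotProduct_lap_nonneg ha ha0 e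
  refine le_trans ?_ (mul_le_mul_of_nonneg_right (hc i) hnn)
  calc l2norm (lap a e i) ^ 2 ≤ (∑ j, a i j * l2norm (e i - e j)) ^ 2 := by
        refine pow_le_pow_left₀ (l2norm_nonneg _) ((l2norm_sum_le _ _).trans_eq ?_) 2
        exact Finset.sum_congr rfl fun j _ => by rw [l2norm_smul, abs_of_nonneg (ha0 i j)]
    _ ≤ Fintype.card ι * ∑ j, (a i j * l2norm (e i - e j)) ^ 2 := by
        simpa using sq_sum_le_card_mul_sum_sq (s := Finset.univ)
          (f := fun j => a i j * l2norm (e i - e j))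
    _ ≤ _ := by
        rw [mul_assoc, Finset.sum_mul]
        refine mul_le_mul_of_nonneg_left (Finset.sum_le_sum fun j _ => ?_) (Nat.cast_nonneg _)
        have := mul_le_mul_of_nonneg_left (weight_mul_sq_le ha ha0 e i j) (ha0 i j)
        linarith

end Laplacian

/-! ### Observability over the network and the error dynamics -/

section Observer

variable {n m mv N Nc : ℕ} {b : Fin Nc → ℕ} {p q r : Fin N → ℕ}
  {S : Plant n m mv N Nc b p q r} {δ : Fin N → ℕ}

theorem IsWeightedAdjacency.nonneg {G : SimpleGraph (Fin N)} {a : Matrix (Fin N) (Fin N) ℝ}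
    (ha : IsWeightedAdjacency G a) (i j : Fin N) : 0 ≤ a i j := by
  by_cases hij : G.Adj i j
  · exact (ha.pos i j hij).le
  · exact (ha.zero i j hij).ge

/-- Total norm of the consensus errors `T_iuᵀ (L e)_i`. -/
def ObserverDesign.consensusNorm (D : ObserverDesign S δ) (a : Matrix (Fin N) (Fin N) ℝ)
    (e : Fin N → Fin n → ℝ) : ℝ := ∑ i, l2norm ((D.Tu i)ᵀ *ᵥ lap a e i)

/-- Total norm of the detectable error components `T_idᵀ e_i`. -/
def ObserverDesign.detectableNorm (D : ObserverDesign S δ) (e : Fin N → Fin n → ℝ) : ℝ :=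
  ∑ i, l2norm ((D.Td i)ᵀ *ᵥ e i)

theorem ObserverDesign.consensusNorm_nonneg (D : ObserverDesign S δ)
    (a : Matrix (Fin N) (Fin N) ℝ) (e : Fin N → Fin n → ℝ) : 0 ≤ D.consensusNorm a e :=
  Finset.sum_nonneg fun _ _ => l2norm_nonneg _

theorem ObserverDesign.detectableNorm_nonneg (D : ObserverDesign S δ)
    (e : Fin N → Fin n → ℝ) : 0 ≤ D.detectableNorm e :=
  Finset.sum_nonneg fun _ _ => l2norm_nonneg _

theorem ObserverDesign.eq_Td_add_Tu (D : ObserverDesign S δ) (i : Fin N) (y : Fin n → ℝ) :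
    y = D.Td i *ᵥ ((D.Td i)ᵀ *ᵥ y) + D.Tu i *ᵥ ((D.Tu i)ᵀ *ᵥ y) := by
  rw [mulVec_mulVec, mulVec_mulVec, D.Tu_compl i, ← add_mulVec, add_sub_cancel, one_mulVec]

/-- A signal on a connected graph that is invisible to all observers vanishes. -/
theorem ObserverDesign.eq_zero_of_invisible (D : ObserverDesign S δ)
    (hdet : D.CollectivelyDetectable) {G : SimpleGraph (Fin N)} {a : Matrix (Fin N) (Fin N) ℝ}
    (ha : IsWeightedAdjacency G a) (hG : G.Connected) {e : Fin N → Fin n → ℝ}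
    (hu : ∀ i, (D.Tu i)ᵀ *ᵥ lap a e i = 0) (hd : ∀ i, (D.Td i)ᵀ *ᵥ e i = 0) : e = 0 := by
  -- As T_idᵀe_i = 0, e_i lies in the image of T_iu and pairs with (Le)_i only through T_iuᵀ(Le)_i =
  -- 0.
  have hsum : ∑ i, e i ⬝ᵥ lap a e i = 0 := Finset.sum_eq_zero fun i _ => by
    rw [D.eq_Td_add_Tu i (e i), hd i, mulVec_zero, zero_add, dotProduct_comm,
      dotProduct_mulVec_transpose, hu i, zero_dotProduct]
  have hadj : ∀ i j, G.Adj i j → e i = e j := fun i j hij => by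
    have h1 := weight_mul_sq_le ha.symm ha.nonneg e i j
    rw [hsum, mul_zero] at h1
    have h2 : l2norm (e i - e j) ^ 2 ≤ 0 := by
      by_contra! h3
      exact absurd (mul_pos (ha.pos i j hij) h3) (not_lt.2 h1)
    have h4 : l2norm (e i - e j) = 0 := by nlinarith [l2norm_nonneg (e i - e j)]
    exact sub_eq_zero.1 (l2norm_eq_zero.1 h4)
  have hconst : ∀ i j, e i = e j := fun i j => by
    obtain ⟨w⟩ := hG.preconnected i j
    induction w with
    | nil => rfl
    | cons hij _ ih => exact (hadj _ _ hij).trans ih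
  funext i
  -- The common value of the e_i is orthogonal to every Im T_jd, hence to the whole space.
  have hle : (⨆ j, LinearMap.range (Matrix.mulVecLin (D.Td j)))
      ≤ LinearMap.ker (dotProductBilin ℝ ℝ (e i)) := by
    refine iSup_le fun j => ?_
    rintro _ ⟨y, rfl⟩
    simp [dotProduct_mulVec_transpose, hconst i j, hd j]
  rw [show (⨆ j, LinearMap.range (Matrix.mulVecLin (D.Td j))) = ⊤ from hdet] at hle
  have : e i ⬝ᵥ e i = 0 := by simpa using hle (Submodule.mem_top (x := e i))
  simpa using dotProduct_self_eq_zero.1 this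

/-- By `eq_zero_of_invisible` the linear map from e to its consensus and detectable data is
injective; in finite dimension it is therefore bounded below. -/
theorem ObserverDesign.exists_norm_le (D : ObserverDesign S δ)
    (hdet : D.CollectivelyDetectable) {G : SimpleGraph (Fin N)} {a : Matrix (Fin N) (Fin N) ℝ}
    (ha : IsWeightedAdjacency G a) (hG : G.Connected) :
    ∃ c : ℝ, 0 ≤ c ∧ ∀ (e : Fin N → Fin n → ℝ) (i : Fin N),
      l2norm (e i) ≤ c * (D.consensusNorm a e + D.detectableNorm e) := by
  let Φ : (Fin N → EuclideanSpace ℝ (Fin n)) →ₗ[ℝ]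
      ((i : Fin N) → EuclideanSpace ℝ (Fin (n - δ i))) ×
        ((i : Fin N) → EuclideanSpace ℝ (Fin (δ i))) :=
    { toFun := fun e => (fun i => WithLp.toLp 2 ((D.Tu i)ᵀ *ᵥ lap a (fun j => (e j).ofLp) i),
        fun i => WithLp.toLp 2 ((D.Td i)ᵀ *ᵥ (e i).ofLp))
      map_add' := fun e f => by
        ext i j
        · have : (fun j => ((e + f) j).ofLp) = (fun j => (e j).ofLp) + fun j => (f j).ofLp := rfl
          simp only [this, lap_add, mulVec_add]
          rfl
        · simp [mulVec_add]
      map_smul' := fun c e => by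
        ext i j
        · have : (fun j => ((c • e) j).ofLp) = c • (fun j => (e j).ofLp) := rfl
          simp only [this, lap_smul, mulVec_smul]
          rfl
        · simp [mulVec_smul] }
  have hker : LinearMap.ker Φ = ⊥ := by
    rw [LinearMap.ker_eq_bot']
    intro e he
    have h1 : ∀ i, (D.Tu i)ᵀ *ᵥ lap a (fun j => (e j).ofLp) i = 0 := fun i => by
      have := congrFun (congrArg Prod.fst he) i
      exact congrArg WithLp.ofLp this
    have h2 : ∀ i, (D.Td i)ᵀ *ᵥ (e i).ofLp = 0 := fun i => by
      have := congrFun (congrArg Prod.snd he) i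
      exact congrArg WithLp.ofLp this
    have h3 := D.eq_zero_of_invisible hdet ha hG h1 h2
    ext i j
    exact congrFun (congrFun h3 i) j
  obtain ⟨c, -, hc⟩ := LinearMap.exists_antilipschitzWith Φ hker
  refine ⟨c, c.2, fun e i => ?_⟩
  have h1 := hc.le_mul_dist (fun j => WithLp.toLp 2 (e j)) 0
  rw [map_zero, dist_zero_right, dist_zero_right] at h1
  have h2 : l2norm (e i) ≤ ‖fun j => (WithLp.toLp 2 (e j) : EuclideanSpace ℝ (Fin n))‖ :=
    norm_le_pi_norm (fun j => (WithLp.toLp 2 (e j) : EuclideanSpace ℝ (Fin n))) i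
  refine (h2.trans h1).trans (mul_le_mul_of_nonneg_left ?_ c.2)
  have hY := D.consensusNorm_nonneg a e
  have hZ := D.detectableNorm_nonneg e
  refine max_le ?_ ?_
  · refine (pi_norm_le_iff_of_nonneg (by linarith)).2 fun j => ?_
    have h4 := Finset.single_le_sum (f := fun j => l2norm ((D.Tu j)ᵀ *ᵥ lap a e j))
      (fun _ _ => l2norm_nonneg _) (Finset.mem_univ j)
    exact le_add_of_le_of_nonneg h4 hZ
  · refine (pi_norm_le_iff_of_nonneg (by linarith)).2 fun j => ?_
    have h4 := Finset.single_le_sum (f := fun j => l2norm ((D.Td j)ᵀ *ᵥ e j))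
      (fun _ _ => l2norm_nonneg _) (Finset.mem_univ j)
    exact le_add_of_nonneg_of_le hY h4

/-- The Sylvester equation makes the plant state drop out of the error dynamics. -/
theorem ObserverDesign.error_matrix_eq_zero (D : ObserverDesign S δ) (i : Fin N) :
    D.Ebar i * (1 - D.Gbar i * S.C i) + D.Fbar i * S.C i - (1 - D.Gbar i * S.C i) * S.A = 0 := by
  have hTuTd : (D.Tu i)ᵀ * D.Td i = 0 := by
    have := congrArg transpose (D.Td_Tu i)
    rwa [transpose_mul, transpose_transpose, transpose_zero] at this
  have h1 : D.Ebar i * D.Gbar i = D.Td i * (D.E i * D.G i)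
      + D.Tu i * (D.Tu i)ᵀ * S.A * D.Gbar i := by
    rw [ObserverDesign.Ebar, Matrix.add_mul]
    congr 1
    rw [ObserverDesign.Gbar, Matrix.mul_assoc, ← Matrix.mul_assoc (D.Td i)ᵀ, D.Td_orth,
      Matrix.one_mul, Matrix.mul_assoc]
  have h2 : D.Td i * (D.E i * (D.Td i)ᵀ + (D.G i * S.C i - (D.Td i)ᵀ) * S.A
    + (D.F i - D.E i * D.G i) * S.C i) = 0 := by rw [D.sylvester, Matrix.mul_zero]
  have h3 : D.Td i * ((D.Td i)ᵀ * S.A) = S.A - D.Tu i * (D.Tu i)ᵀ * S.A := by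
    rw [D.Tu_compl, Matrix.sub_mul, Matrix.one_mul, Matrix.mul_assoc]
    abel
  rw [Matrix.mul_sub, Matrix.mul_one, ← Matrix.mul_assoc, h1]
  simp only [Matrix.sub_mul, Matrix.mul_add, Matrix.mul_sub, h3] at h2
  rw [← h2, ObserverDesign.Ebar, ObserverDesign.Fbar, ObserverDesign.Gbar]
  simp only [Matrix.add_mul, Matrix.sub_mul, Matrix.one_mul, Matrix.mul_assoc]
  abel

/-- The condition G_iC_iB_{-i} = T_idᵀB_{-i} removes exactly the T_id component of the hidden input,
so that input enters only where the sliding term acts. -/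
theorem ObserverDesign.decoupled_input (D : ObserverDesign S δ) (i : Fin N) :
    (1 - D.Gbar i * S.C i) * S.Bneg i = D.Tu i * (D.Tu i)ᵀ * S.Bneg i := by
  rw [D.Tu_compl, Matrix.sub_mul, Matrix.sub_mul, ObserverDesign.Gbar, Matrix.mul_assoc,
    Matrix.mul_assoc, ← Matrix.mul_assoc (D.G i), D.decouple, Matrix.mul_assoc]

/-- Estimation error `x̂_i - x`. -/
def ObserverDesign.err (D : ObserverDesign S δ) (x : Fin n → ℝ) (z : Fin N → Fin n → ℝ)
    (i : Fin N) : Fin n → ℝ := D.xhat x z i - x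

theorem ObserverDesign.epsu_eq (D : ObserverDesign S δ) (a : Matrix (Fin N) (Fin N) ℝ)
    (x : Fin n → ℝ) (z : Fin N → Fin n → ℝ) (i : Fin N) :
    D.epsu a x z i = (D.Tu i)ᵀ *ᵥ lap a (D.err x z) i := by
  simp [ObserverDesign.epsu, lap, ObserverDesign.err]

/-- The part of the total input that is unavailable to observer node `i`. -/
def Plant.hiddenInput (S : Plant n m mv N Nc b p q r) (u : ∀ κ, Fin (b κ) → ℝ)
    (v : Fin mv → ℝ) (i : Fin N) : Fin n → ℝ :=
  ∑ κ, S.Bc κ *ᵥ u κ + S.Bv *ᵥ v - S.Bloc i *ᵥ (S.S i *ᵥ stack u)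

/-- Error dynamics of an observer node. -/
theorem ObserverDesign.error_dynamics (D : ObserverDesign S δ) (i : Fin N)
    {x dx zi dzi : Fin n → ℝ} {u : ∀ κ, Fin (b κ) → ℝ} {v : Fin mv → ℝ}
    {γ γs : ℝ} {ε w : Fin (n - δ i) → ℝ}
    (hx : dx = S.A *ᵥ x + ∑ κ, S.Bc κ *ᵥ u κ + S.Bv *ᵥ v)
    (hz : dzi = D.Ebar i *ᵥ zi + D.Fbar i *ᵥ (S.C i *ᵥ x)
      + D.Bbar i *ᵥ (S.S i *ᵥ stack u) - (γ • (D.Tu i *ᵥ ε) + γs • (D.Tu i *ᵥ w))) :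
    dzi + D.Gbar i *ᵥ (S.C i *ᵥ dx) - dx
      = D.Td i *ᵥ (D.E i *ᵥ ((D.Td i)ᵀ *ᵥ (zi + D.Gbar i *ᵥ (S.C i *ᵥ x) - x)))
        + D.Tu i *ᵥ ((D.Tu i)ᵀ *ᵥ (S.A *ᵥ (zi + D.Gbar i *ᵥ (S.C i *ᵥ x) - x)
          - S.hiddenInput u v i) - γ • ε - γs • w) := by
  obtain ⟨uneg, huneg⟩ := S.split i u v
  set M := 1 - D.Gbar i * S.C i with hM
  set e := zi + D.Gbar i *ᵥ (S.C i *ᵥ x) - x with he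
  have hg : S.hiddenInput u v i = S.Bneg i *ᵥ uneg := by
    rw [Plant.hiddenInput, huneg, add_sub_cancel_left]
  have hdx : dx = S.A *ᵥ x + S.Bloc i *ᵥ (S.S i *ᵥ stack u) + S.hiddenInput u v i := by
    rw [hx, Plant.hiddenInput]
    abel
  have hzi : zi = e + M *ᵥ x := by
    rw [he, hM, sub_mulVec, one_mulVec, ← mulVec_mulVec]
    abel
  have hMdx : D.Gbar i *ᵥ (S.C i *ᵥ dx) - dx = -(M *ᵥ dx) := by
    rw [hM, sub_mulVec, one_mulVec, ← mulVec_mulVec]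
    abel
  have hMg : M *ᵥ S.hiddenInput u v i = D.Tu i *ᵥ ((D.Tu i)ᵀ *ᵥ S.hiddenInput u v i) := by
    rw [hg, mulVec_mulVec, hM, D.decoupled_input, ← mulVec_mulVec, ← mulVec_mulVec]
  have hzero : D.Ebar i *ᵥ (M *ᵥ x) + D.Fbar i *ᵥ (S.C i *ᵥ x) - M *ᵥ (S.A *ᵥ x) = 0 := by
    have h0 := D.error_matrix_eq_zero i
    rw [← hM] at h0
    have := congrArg (· *ᵥ x) h0
    simpa only [sub_mulVec, add_mulVec, ← mulVec_mulVec, zero_mulVec] using this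
  have hE : D.Ebar i *ᵥ e = D.Td i *ᵥ (D.E i *ᵥ ((D.Td i)ᵀ *ᵥ e))
      + D.Tu i *ᵥ ((D.Tu i)ᵀ *ᵥ (S.A *ᵥ e)) := by
    simp only [ObserverDesign.Ebar, add_mulVec, ← mulVec_mulVec]
  have hB : D.Bbar i *ᵥ (S.S i *ᵥ stack u) = M *ᵥ (S.Bloc i *ᵥ (S.S i *ᵥ stack u)) := by
    rw [ObserverDesign.Bbar, ← mulVec_mulVec]
  have hsplit : D.Ebar i *ᵥ zi = D.Ebar i *ᵥ e + D.Ebar i *ᵥ (M *ᵥ x) := by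
    rw [← mulVec_add, ← hzi]
  rw [add_sub_assoc, hMdx, hdx, hz, hB, hsplit, hE]
  simp only [mulVec_add, mulVec_sub, mulVec_smul, hMg]
  rw [← sub_eq_zero, ← hzero]
  abel

end Observer

/-! ### Stacked controller inputs -/

section Stack

variable {n Nc : ℕ} {b : Fin Nc → ℕ}

theorem l2norm_stack_sq (u : ∀ κ, Fin (b κ) → ℝ) :
    l2norm (stack u) ^ 2 = ∑ κ, l2norm (u κ) ^ 2 := by
  simp only [l2norm_sq, dotProduct, Fintype.sum_sigma, stack]

theorem l2norm_stack_le (u : ∀ κ, Fin (b κ) → ℝ) : l2norm (stack u) ≤ ∑ κ, l2norm (u κ) := by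
  refine le_of_sq_le_sq ?_ (Finset.sum_nonneg fun κ _ => l2norm_nonneg (u κ))
  rw [l2norm_stack_sq]
  exact Finset.sum_sq_le_sq_sum_of_nonneg fun κ _ => l2norm_nonneg (u κ)

theorem l2norm_le_l2norm_stack (u : ∀ κ, Fin (b κ) → ℝ) (κ : Fin Nc) :
    l2norm (u κ) ≤ l2norm (stack u) := by
  refine le_of_sq_le_sq ?_ (l2norm_nonneg _)
  rw [l2norm_stack_sq]
  exact Finset.single_le_sum (f := fun κ => l2norm (u κ) ^ 2) (fun _ _ => sq_nonneg _)
    (Finset.mem_univ κ)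

theorem blockRow_mulVec_stack (Bc : ∀ κ, Matrix (Fin n) (Fin (b κ)) ℝ)
    (u : ∀ κ, Fin (b κ) → ℝ) : blockRow Bc *ᵥ stack u = ∑ κ, Bc κ *ᵥ u κ := by
  ext i
  simp [mulVec, dotProduct, Fintype.sum_sigma, blockRow, stack, Finset.sum_apply]

end Stack

/-- Unit-vector feedback of sufficient gain dominates a bounded matched disturbance. -/
theorem dotProduct_sub_smul_nonpos {k : Type*} [Fintype k] {ω s d : k → ℝ} {β : ℝ}
    (hs : s ∈ hSet ω) (hd : l2norm d ≤ β) : ω ⬝ᵥ (d - β • s) ≤ 0 := by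
  rw [dotProduct_sub, dotProduct_smul, smul_eq_mul, dotProduct_of_mem_hSet hs]
  nlinarith [dotProduct_le_l2norm ω d, mul_le_mul_of_nonneg_left hd (l2norm_nonneg ω)]

/-! ### Separate dissipation estimates for plant and observers -/

section Dissipation

variable {n m mv N Nc : ℕ} {b : Fin Nc → ℕ} {p q r : Fin N → ℕ}
  {S : Plant n m mv N Nc b p q r} {δ : Fin N → ℕ}

/-- Decay of the plant's Lyapunov function, up to terms of first order in the estimation error. -/
theorem Plant.exists_decay (S : Plant n m mv N Nc b p q r)
    (Bt : Matrix ((κ : Fin Nc) × Fin (b κ)) (Fin m) ℝ) (hBt : S.B = blockRow S.Bc * Bt)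
    (Xv : Matrix (Fin m) (Fin mv) ℝ) (hmatch : S.B * Xv = S.Bv)
    {vbar : ℝ} (K : ∀ κ, Matrix (Fin (b κ)) (Fin n) ℝ) {P : Matrix (Fin n) (Fin n) ℝ}
    (hP : Pᵀ = P)
    (hLyap : (-((S.A + ∑ κ, S.Bc κ * K κ)ᵀ * P + P * (S.A + ∑ κ, S.Bc κ * K κ))).PosDef)
    {β : Fin Nc → ℝ} (hβ : ∀ κ, vbar * opNorm2 (Bt * Xv) ≤ β κ) :
    ∃ lam c : ℝ, 0 < lam ∧ 0 ≤ c ∧ ∀ (x : Fin n → ℝ) (e : Fin Nc → Fin n → ℝ) (R : ℝ)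
      (v : Fin mv → ℝ) (s : ∀ κ, Fin (b κ) → ℝ), l2norm v ≤ vbar →
      (∀ κ, l2norm (e κ) ≤ R) → (∀ κ, s κ ∈ hSet ((S.Bc κ)ᵀ *ᵥ (P *ᵥ (x + e κ)))) →
      2 * (x ⬝ᵥ P *ᵥ (S.A *ᵥ x + ∑ κ, S.Bc κ *ᵥ (K κ *ᵥ (x + e κ) - β κ • s κ) + S.Bv *ᵥ v))
        ≤ -lam * l2norm x ^ 2 + c * (l2norm x * R + R) := by
  obtain ⟨lam, hlam, hquad⟩ := exists_pos_quadratic_lower_bound hLyap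
  set Acl := S.A + ∑ κ, S.Bc κ * K κ with hAcl
  set c₁ := ∑ κ, 2 * opNorm2 (P * S.Bc κ * K κ) with hc₁
  set c₂ := ∑ κ, 4 * |β κ| * opNorm2 ((S.Bc κ)ᵀ * P) with hc₂
  have hc₁0 : 0 ≤ c₁ := Finset.sum_nonneg fun κ _ => mul_nonneg (by norm_num) (opNorm2_nonneg _)
  have hc₂0 : 0 ≤ c₂ := Finset.sum_nonneg fun κ _ => mul_nonneg (by positivity) (opNorm2_nonneg _)
  refine ⟨lam, c₁ + c₂, hlam, by linarith, fun x e R v s hv he hs => ?_⟩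
  have hX := l2norm_nonneg x
  -- The matching condition and B̃ split the disturbance into one equivalent input per controller
  -- channel, each within reach of β^κ.
  set d : ∀ κ, Fin (b κ) → ℝ := fun κ j => ((Bt * Xv) *ᵥ v) ⟨κ, j⟩ with hd
  have hstack : stack d = (Bt * Xv) *ᵥ v := rfl
  have hBv : S.Bv *ᵥ v = ∑ κ, S.Bc κ *ᵥ d κ := by
    rw [← hmatch, hBt, Matrix.mul_assoc, ← mulVec_mulVec, ← hstack, blockRow_mulVec_stack]
  have hdβ : ∀ κ, l2norm (d κ) ≤ β κ := fun κ => by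
    refine le_trans ?_ (hβ κ)
    refine (l2norm_le_l2norm_stack d κ).trans ?_
    rw [hstack, mul_comm]
    exact (l2norm_mulVec_le _ _).trans (mul_le_mul_of_nonneg_left hv (opNorm2_nonneg _))
  have hdecomp : S.A *ᵥ x + ∑ κ, S.Bc κ *ᵥ (K κ *ᵥ (x + e κ) - β κ • s κ) + S.Bv *ᵥ v
      = Acl *ᵥ x + ∑ κ, S.Bc κ *ᵥ (K κ *ᵥ e κ) + ∑ κ, S.Bc κ *ᵥ (d κ - β κ • s κ) := by
    rw [hBv, hAcl, add_mulVec, Matrix.sum_mulVec]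
    simp only [mulVec_add, mulVec_sub, Finset.sum_add_distrib, Finset.sum_sub_distrib,
      ← mulVec_mulVec]
    abel
  have h1 : 2 * (x ⬝ᵥ P *ᵥ (Acl *ᵥ x)) ≤ -lam * l2norm x ^ 2 := by
    have hquadx := hquad x
    have hcomm : x ⬝ᵥ Aclᵀ *ᵥ (P *ᵥ x) = x ⬝ᵥ P *ᵥ (Acl *ᵥ x) := by
      rw [dotProduct_mulVec_transpose Aclᵀ, transpose_transpose, dotProduct_mulVec_transpose P, hP,
        dotProduct_comm]
    rw [neg_mulVec, dotProduct_neg, add_mulVec, dotProduct_add, ← mulVec_mulVec,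
      ← mulVec_mulVec, hcomm] at hquadx
    linarith
  have h2 : 2 * (x ⬝ᵥ P *ᵥ ∑ κ, S.Bc κ *ᵥ (K κ *ᵥ e κ)) ≤ c₁ * (l2norm x * R) := by
    rw [mulVec_sum, dotProduct_sum, Finset.mul_sum, hc₁, Finset.sum_mul]
    refine Finset.sum_le_sum fun κ _ => ?_
    rw [mulVec_mulVec, mulVec_mulVec, mul_assoc]
    have h3 := (le_abs_self _).trans (abs_dotProduct_mulVec_le (P * S.Bc κ * K κ) x (e κ))
    have h4 := mul_le_mul_of_nonneg_left (he κ)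
      (mul_nonneg (opNorm2_nonneg (P * S.Bc κ * K κ)) hX)
    linarith
  have h5 : 2 * (x ⬝ᵥ P *ᵥ ∑ κ, S.Bc κ *ᵥ (d κ - β κ • s κ)) ≤ c₂ * R := by
    rw [mulVec_sum, dotProduct_sum, Finset.mul_sum, hc₂, Finset.sum_mul]
    refine Finset.sum_le_sum fun κ _ => ?_
    -- The feedback uses the estimate, so the sign argument holds at x + e. Returning to x costs a
    -- term linear in e, since d - βs is bounded.
    have h6 : x ⬝ᵥ P *ᵥ (S.Bc κ *ᵥ (d κ - β κ • s κ))
        = ((S.Bc κ)ᵀ *ᵥ (P *ᵥ (x + e κ))) ⬝ᵥ (d κ - β κ • s κ)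
          - (((S.Bc κ)ᵀ * P) *ᵥ e κ) ⬝ᵥ (d κ - β κ • s κ) := by
      rw [dotProduct_mulVec_transpose, hP, dotProduct_mulVec_transpose, ← sub_dotProduct,
        ← mulVec_mulVec, ← mulVec_sub, ← mulVec_sub, add_sub_cancel_right]
    have h7 := dotProduct_sub_smul_nonpos (hs κ) (hdβ κ)
    have h8 := neg_dotProduct_le_l2norm (((S.Bc κ)ᵀ * P) *ᵥ e κ) (d κ - β κ • s κ)
    have hβ0 : β κ ≤ |β κ| := le_abs_self _
    have h9 : l2norm (d κ - β κ • s κ) ≤ 2 * |β κ| := by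
      refine (l2norm_sub_le _ _).trans ?_
      rw [l2norm_smul]
      have := mul_le_mul_of_nonneg_left (l2norm_le_one_of_mem_hSet (hs κ)) (abs_nonneg (β κ))
      linarith [hdβ κ]
    have h10 : l2norm (((S.Bc κ)ᵀ * P) *ᵥ e κ) ≤ opNorm2 ((S.Bc κ)ᵀ * P) * R :=
      (l2norm_mulVec_le _ _).trans (mul_le_mul_of_nonneg_left (he κ) (opNorm2_nonneg _))
    have h11 := mul_le_mul h10 h9 (l2norm_nonneg _) ((l2norm_nonneg _).trans h10)
    rw [h6]
    linarith
  rw [hdecomp, mulVec_add, mulVec_add, dotProduct_add, dotProduct_add]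
  -- Without controllers nothing forces R ≥ 0, but then both constants are zero.
  rcases Nat.eq_zero_or_pos Nc with rfl | hNc
  · simp only [Finset.univ_eq_empty, Finset.sum_empty] at hc₁ hc₂
    rw [hc₁, zero_mul] at h2
    rw [hc₂, zero_mul] at h5
    rw [hc₁, hc₂]
    linarith
  · have hR : 0 ≤ R := (l2norm_nonneg _).trans (he ⟨0, hNc⟩)
    nlinarith [mul_nonneg hc₁0 hR, mul_nonneg hc₂0 (mul_nonneg hX hR)]

/-- The right-hand side contains the state-dependent controls: this is how the plant state enters
the observer estimate. -/
theorem Plant.exists_hiddenInput_le (S : Plant n m mv N Nc b p q r) :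
    ∃ c : ℝ, 0 ≤ c ∧ ∀ (u : ∀ κ, Fin (b κ) → ℝ) (v : Fin mv → ℝ) (i : Fin N),
      l2norm (S.hiddenInput u v i) ≤ c * (∑ κ, l2norm (u κ) + l2norm v) := by
  obtain ⟨c₁, hc₁0, hc₁⟩ := exists_uniform_bound fun κ => opNorm2 (S.Bc κ)
  obtain ⟨c₂, hc₂0, hc₂⟩ := exists_uniform_bound fun i => opNorm2 (S.Bloc i * S.S i)
  have hv0 := opNorm2_nonneg S.Bv
  refine ⟨c₁ + opNorm2 S.Bv + c₂, by linarith, fun u v i => ?_⟩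
  have hU : 0 ≤ ∑ κ, l2norm (u κ) := Finset.sum_nonneg fun κ _ => l2norm_nonneg _
  have hV := l2norm_nonneg v
  have h1 : l2norm (∑ κ, S.Bc κ *ᵥ u κ) ≤ c₁ * ∑ κ, l2norm (u κ) := by
    refine (l2norm_sum_le _ _).trans ?_
    rw [Finset.mul_sum]
    exact Finset.sum_le_sum fun κ _ => (l2norm_mulVec_le _ _).trans
      (mul_le_mul_of_nonneg_right (hc₁ κ) (l2norm_nonneg _))
  have h2 : l2norm (S.Bloc i *ᵥ (S.S i *ᵥ stack u)) ≤ c₂ * ∑ κ, l2norm (u κ) := by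
    rw [mulVec_mulVec]
    exact (l2norm_mulVec_le _ _).trans
      (mul_le_mul (hc₂ i) (l2norm_stack_le u) (l2norm_nonneg _) hc₂0)
  have h3 := l2norm_mulVec_le S.Bv v
  have h4 := l2norm_sub_le (∑ κ, S.Bc κ *ᵥ u κ + S.Bv *ᵥ v) (S.Bloc i *ᵥ (S.S i *ᵥ stack u))
  have h5 := l2norm_add_le (∑ κ, S.Bc κ *ᵥ u κ) (S.Bv *ᵥ v)
  rw [Plant.hiddenInput]
  nlinarith [mul_nonneg hc₁0 hV, mul_nonneg hc₂0 hV, mul_nonneg hv0 hU]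

/-- Decay of the disagreement function along the error dynamics of the observer network. -/
theorem ObserverDesign.exists_decay (D : ObserverDesign S δ) (a : Matrix (Fin N) (Fin N) ℝ)
    {c₀ : ℝ} (hc₀ : 0 ≤ c₀) (hrec : ∀ (e : Fin N → Fin n → ℝ) (i : Fin N),
      l2norm (e i) ≤ c₀ * (D.consensusNorm a e + D.detectableNorm e)) :
    ∃ c : ℝ, 0 ≤ c ∧ ∀ (e g : Fin N → Fin n → ℝ) (γ γs : Fin N → ℝ)
      (w : ∀ i, Fin (n - δ i) → ℝ) (M : ℝ), (∀ i, l2norm (g i) ≤ M) →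
      (∀ i, w i ∈ hSet ((D.Tu i)ᵀ *ᵥ lap a e i)) →
      ∑ i, (D.Td i *ᵥ (D.E i *ᵥ ((D.Td i)ᵀ *ᵥ e i)) + D.Tu i *ᵥ ((D.Tu i)ᵀ *ᵥ
          (S.A *ᵥ e i - g i) - γ i • ((D.Tu i)ᵀ *ᵥ lap a e i) - γs i • w i)) ⬝ᵥ lap a e i
        + ∑ i, γ i * l2norm ((D.Tu i)ᵀ *ᵥ lap a e i) ^ 2
        + ∑ i, γs i * l2norm ((D.Tu i)ᵀ *ᵥ lap a e i)
      ≤ c * ((D.consensusNorm a e + D.detectableNorm e) * D.detectableNorm e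
          + D.consensusNorm a e * (D.consensusNorm a e + D.detectableNorm e + M)) := by
  obtain ⟨cL, hcL0, hcL⟩ := exists_lap_le (k := Fin n) a
  obtain ⟨c₁, hc₁0, hc₁⟩ := exists_uniform_bound fun i => opNorm2 (D.Td i * D.E i)
  obtain ⟨c₂, hc₂0, hc₂⟩ := exists_uniform_bound fun i => opNorm2 (D.Tu i)ᵀ
  have hA0 := opNorm2_nonneg S.A
  refine ⟨c₁ * (cL * c₀) + c₂ * (opNorm2 S.A * c₀) + c₂, by positivity,
    fun e g γ γs w M hg hw => ?_⟩
  have hY := D.consensusNorm_nonneg a e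
  have hZ := D.detectableNorm_nonneg e
  set Y := D.consensusNorm a e with hYdef
  set Z := D.detectableNorm e with hZdef
  have hlap : ∀ i, l2norm (lap a e i) ≤ cL * c₀ * (Y + Z) := fun i => by
    rw [mul_assoc]; exact hcL e _ (hrec e) i
  have hterm : ∀ i, (D.Td i *ᵥ (D.E i *ᵥ ((D.Td i)ᵀ *ᵥ e i)) + D.Tu i *ᵥ ((D.Tu i)ᵀ *ᵥ
          (S.A *ᵥ e i - g i) - γ i • ((D.Tu i)ᵀ *ᵥ lap a e i) - γs i • w i)) ⬝ᵥ lap a e i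
        + γ i * l2norm ((D.Tu i)ᵀ *ᵥ lap a e i) ^ 2
        + γs i * l2norm ((D.Tu i)ᵀ *ᵥ lap a e i)
      ≤ c₁ * (cL * c₀ * (Y + Z)) * l2norm ((D.Td i)ᵀ *ᵥ e i)
        + l2norm ((D.Tu i)ᵀ *ᵥ lap a e i) * (c₂ * (opNorm2 S.A * (c₀ * (Y + Z)) + M)) := by
    intro i
    rw [add_dotProduct, dotProduct_comm, dotProduct_comm (D.Tu i *ᵥ _) (lap a e i),
      dotProduct_mulVec_transpose (D.Tu i), dotProduct_sub, dotProduct_sub, dotProduct_smul,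
      dotProduct_smul, smul_eq_mul, smul_eq_mul, dotProduct_of_mem_hSet (hw i), ← l2norm_sq,
      mulVec_mulVec]
    have h1 := (le_abs_self _).trans
      (abs_dotProduct_mulVec_le (D.Td i * D.E i) (lap a e i) ((D.Td i)ᵀ *ᵥ e i))
    have h2 : opNorm2 (D.Td i * D.E i) * l2norm (lap a e i) * l2norm ((D.Td i)ᵀ *ᵥ e i)
        ≤ c₁ * (cL * c₀ * (Y + Z)) * l2norm ((D.Td i)ᵀ *ᵥ e i) :=
      mul_le_mul_of_nonneg_right (mul_le_mul (hc₁ i) (hlap i) (l2norm_nonneg _) hc₁0)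
        (l2norm_nonneg _)
    have h3 := dotProduct_le_l2norm ((D.Tu i)ᵀ *ᵥ lap a e i) ((D.Tu i)ᵀ *ᵥ (S.A *ᵥ e i - g i))
    have h4 : l2norm (S.A *ᵥ e i - g i) ≤ opNorm2 S.A * (c₀ * (Y + Z)) + M := by
      refine (l2norm_sub_le _ _).trans (add_le_add ?_ (hg i))
      exact (l2norm_mulVec_le _ _).trans (mul_le_mul_of_nonneg_left (hrec e i) hA0)
    have h5 : l2norm ((D.Tu i)ᵀ *ᵥ (S.A *ᵥ e i - g i))
        ≤ c₂ * (opNorm2 S.A * (c₀ * (Y + Z)) + M) :=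
      (l2norm_mulVec_le _ _).trans (mul_le_mul (hc₂ i) h4 (l2norm_nonneg _) hc₂0)
    have h6 := mul_le_mul_of_nonneg_left h5 (l2norm_nonneg ((D.Tu i)ᵀ *ᵥ lap a e i))
    linarith
  have hsum := Finset.sum_le_sum fun i (_ : i ∈ Finset.univ) => hterm i
  rw [Finset.sum_add_distrib, Finset.sum_add_distrib, Finset.sum_add_distrib, ← Finset.mul_sum,
    ← Finset.sum_mul] at hsum
  rw [ObserverDesign.consensusNorm] at hYdef
  rw [ObserverDesign.detectableNorm] at hZdef
  rw [← hYdef, ← hZdef] at hsum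
  refine hsum.trans ?_
  rcases Nat.eq_zero_or_pos N with rfl | hN
  · simp only [Finset.univ_eq_empty, Finset.sum_empty] at hYdef hZdef
    simp [hYdef, hZdef]
  have hM : 0 ≤ M := (l2norm_nonneg _).trans (hg ⟨0, hN⟩)
  have e1 : 0 ≤ c₁ * (cL * c₀) * (Y * (Y + Z + M)) := by positivity
  have e2 : 0 ≤ c₂ * (opNorm2 S.A * c₀) * ((Y + Z) * Z + Y * M) := by positivity
  have e3 : 0 ≤ c₂ * ((Y + Z) * Z + Y * (Y + Z)) := by positivity
  linarith

end Dissipation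

/-- Completion of squares: adaptive gains exceeding a threshold dominate the cross terms. -/
theorem exists_dominating_gain {lam c N : ℝ} (hlam : 0 < lam) (hc : 0 ≤ c) (hN : 0 ≤ N) :
    ∃ g κ C : ℝ, 0 < κ ∧ 0 ≤ C ∧ ∀ X Y Z Y₂ V : ℝ, 0 ≤ X → 0 ≤ Y → 0 ≤ Z → Y ^ 2 ≤ N * Y₂ →
      0 ≤ Y₂ → V ≤ c * (X ^ 2 + (Y + Z) ^ 2) →
      -lam * X ^ 2 + c * (X * (Y + Z) + (Y + Z) + (Y + Z) * Z + Y * (X + Y + Z + 1))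
        - g * Y₂ - g * Y ≤ -κ * V + C * (Z + Z ^ 2) := by
  -- A collects the Y² coefficients: 4c²/lam from XY, 2c from YZ and the explicit Y², and 1 from κV.
  -- In the gain, N·A pays for Y² ≤ N·Y₂ and 2c pays for the two linear terms cY.
  set A := 4 * c ^ 2 / lam + 2 * c + 1 with hA
  have hA0 : 0 ≤ A := by positivity
  have hD : 0 < c * (4 / lam + 2) + 1 := by positivity
  refine ⟨N * A + 2 * c, 1 / (c * (4 / lam + 2) + 1), c ^ 2 / lam + 2 * c + 1, by positivity,
    by positivity, fun X Y Z Y₂ V hX hY hZ hY₂ hY₂0 hV => ?_⟩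
  set κ := 1 / (c * (4 / lam + 2) + 1) with hκ
  have hκ0 : 0 < κ := by positivity
  have hκc : κ * (c * (4 / lam + 2)) ≤ 1 := by
    rw [hκ, one_div_mul_eq_div, div_le_one hD]; linarith
  have hκ1 : κ * c ≤ lam / 4 := by
    have h1 : κ * c * (4 / lam) ≤ 1 := by nlinarith [mul_nonneg hκ0.le hc]
    rw [mul_div_assoc', div_le_one hlam] at h1
    linarith
  have hκ2 : κ * c * 2 ≤ 1 := by
    have : 0 ≤ κ * c * (4 / lam) := by positivity
    nlinarith
  have hκV : κ * V ≤ lam / 4 * X ^ 2 + (Y ^ 2 + Z ^ 2) := by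
    have h1 := mul_le_mul_of_nonneg_left hV hκ0.le
    have h2 := mul_le_mul_of_nonneg_right hκ1 (sq_nonneg X)
    have h3 := mul_le_mul_of_nonneg_right hκ2 (add_nonneg (sq_nonneg Y) (sq_nonneg Z))
    have h4 : κ * c * (Y + Z) ^ 2 ≤ κ * c * (2 * (Y ^ 2 + Z ^ 2)) :=
      mul_le_mul_of_nonneg_left (by nlinarith [sq_nonneg (Y - Z)]) (by positivity)
    linarith
  have hXY : 2 * c * (X * Y) ≤ lam / 4 * X ^ 2 + 4 * c ^ 2 / lam * Y ^ 2 := by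
    have h1 : lam / 4 * X ^ 2 + 4 * c ^ 2 / lam * Y ^ 2 - 2 * c * (X * Y)
        = (lam * X - 4 * c * Y) ^ 2 / (4 * lam) := by field_simp; ring
    have h2 : 0 ≤ (lam * X - 4 * c * Y) ^ 2 / (4 * lam) := by positivity
    linarith
  have hXZ : c * (X * Z) ≤ lam / 4 * X ^ 2 + c ^ 2 / lam * Z ^ 2 := by
    have h1 : lam / 4 * X ^ 2 + c ^ 2 / lam * Z ^ 2 - c * (X * Z)
        = (lam * X - 2 * c * Z) ^ 2 / (4 * lam) := by field_simp; ring
    have h2 : 0 ≤ (lam * X - 2 * c * Z) ^ 2 / (4 * lam) := by positivity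
    linarith
  have hYZ : c * (2 * (Y * Z)) ≤ c * (Y ^ 2 + Z ^ 2) :=
    mul_le_mul_of_nonneg_left (by nlinarith [sq_nonneg (Y - Z)]) hc
  have hgain : A * Y ^ 2 ≤ N * A * Y₂ := by
    have := mul_le_mul_of_nonneg_left hY₂ hA0; linarith
  have hN1 : 0 ≤ N * A * Y := by positivity
  have hcY₂ : 0 ≤ c * Y₂ := by positivity
  have hlX : 0 ≤ lam * X ^ 2 := by positivity
  have hcZ : 0 ≤ (c ^ 2 / lam + c + 1) * Z := by positivity
  rw [hA] at hgain hN1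
  linarith

/-! ### The joint energy and its dissipation inequality -/

section ClosedLoopAnalysis

variable {n m mv N Nc : ℕ} {b : Fin Nc → ℕ} {p q r : Fin N → ℕ}
  {S : Plant n m mv N Nc b p q r} {δ : Fin N → ℕ}

/-- Lyapunov function of plant state and estimation errors: `xᵀ P x` plus the disagreement of the
errors over the graph. -/
def energy (P : Matrix (Fin n) (Fin n) ℝ) (a : Matrix (Fin N) (Fin N) ℝ) (x : Fin n → ℝ)
    (e : Fin N → Fin n → ℝ) : ℝ :=
  x ⬝ᵥ P *ᵥ x + 1 / 2 * ∑ i, e i ⬝ᵥ lap a e i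

/-- Multiplying the error equation by T_idᵀ annihilates the T_iu part, which carries the hidden
input and all adaptive and switching terms. -/
theorem ClosedLoop.err_deriv {D : ObserverDesign S δ} {a : Matrix (Fin N) (Fin N) ℝ}
    {K : ∀ κ, Matrix (Fin (b κ)) (Fin n) ℝ} {P : Matrix (Fin n) (Fin n) ℝ} {β : Fin Nc → ℝ}
    {node : Fin Nc → Fin N} {v : Fin mv → ℝ} {x dx : Fin n → ℝ} {z dz : Fin N → Fin n → ℝ}
    {γ γs dγ dγs : Fin N → ℝ} (hcl : ClosedLoop D a K P β node v x z γ γs dx dz dγ dγs)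
    (i : Fin N) :
    (D.Td i)ᵀ *ᵥ D.err dx dz i = D.E i *ᵥ ((D.Td i)ᵀ *ᵥ D.err x z i) := by
  obtain ⟨s, w, u, -, -, -, hdx, hdz, -⟩ := hcl
  have h1 := D.error_dynamics i hdx (hdz i)
  rw [ObserverDesign.err, ObserverDesign.xhat, h1, mulVec_add, mulVec_mulVec, D.Td_orth,
    one_mulVec, mulVec_mulVec _ (D.Td i)ᵀ (D.Tu i), D.Td_Tu, zero_mulVec, add_zero]
  rfl

/-- Dissipation inequality of the closed loop at one instant. -/
theorem ObserverDesign.exists_dissipation (D : ObserverDesign S δ)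
    (hdet : D.CollectivelyDetectable) {G : SimpleGraph (Fin N)} {a : Matrix (Fin N) (Fin N) ℝ}
    (ha : IsWeightedAdjacency G a) (hG : G.Connected)
    (Bt : Matrix ((κ : Fin Nc) × Fin (b κ)) (Fin m) ℝ) (hBt : S.B = blockRow S.Bc * Bt)
    (Xv : Matrix (Fin m) (Fin mv) ℝ) (hmatch : S.B * Xv = S.Bv) {vbar : ℝ}
    (K : ∀ κ, Matrix (Fin (b κ)) (Fin n) ℝ) {P : Matrix (Fin n) (Fin n) ℝ} (hP : Pᵀ = P)
    (hLyap : (-((S.A + ∑ κ, S.Bc κ * K κ)ᵀ * P + P * (S.A + ∑ κ, S.Bc κ * K κ))).PosDef)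
    {β : Fin Nc → ℝ} (hβ : ∀ κ, vbar * opNorm2 (Bt * Xv) ≤ β κ) (node : Fin Nc → Fin N) :
    ∃ g κ C : ℝ, 0 < κ ∧ 0 ≤ C ∧ ∀ (v : Fin mv → ℝ) (x dx : Fin n → ℝ)
      (z dz : Fin N → Fin n → ℝ) (γ γs dγ dγs : Fin N → ℝ), l2norm v ≤ vbar →
      ClosedLoop D a K P β node v x z γ γs dx dz dγ dγs →
      2 * (x ⬝ᵥ P *ᵥ dx) + ∑ i, D.err dx dz i ⬝ᵥ lap a (D.err x z) i
        + ∑ i, (γ i - g) * l2norm (D.epsu a x z i) ^ 2 + ∑ i, (γs i - g) * l2norm (D.epsu a x z i)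
      ≤ -κ * energy P a x (D.err x z)
        + C * (D.detectableNorm (D.err x z) + D.detectableNorm (D.err x z) ^ 2) := by
  obtain ⟨c₀, hc₀, hrec⟩ := D.exists_norm_le hdet ha hG
  obtain ⟨lam, c₁, hlam, hc₁, hplant⟩ := S.exists_decay Bt hBt Xv hmatch K hP hLyap hβ
  obtain ⟨c₃, hc₃, hhidden⟩ := S.exists_hiddenInput_le
  obtain ⟨c₄, hc₄, hobs⟩ := D.exists_decay a hc₀ hrec
  obtain ⟨cL, hcL, hlap⟩ := exists_lap_le (k := Fin n) a
  set cu := ∑ κ, (opNorm2 (K κ) + |β κ|) with hcu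
  have hcu0 : 0 ≤ cu := Finset.sum_nonneg fun κ _ => add_nonneg (opNorm2_nonneg _) (abs_nonneg _)
  set c₅ := c₃ * (cu * (1 + c₀) + |vbar|) with hc₅
  have hc₅0 : 0 ≤ c₅ := by positivity
  have hP0 := opNorm2_nonneg P
  set c := c₁ * c₀ + c₄ * (1 + c₅) + opNorm2 P + N * (c₀ * (cL * c₀)) with hc
  have hn₁ : 0 ≤ c₁ * c₀ := mul_nonneg hc₁ hc₀
  have hn₂ : 0 ≤ c₄ * (1 + c₅) := mul_nonneg hc₄ (by linarith)
  have hn₃ : 0 ≤ N * (c₀ * (cL * c₀)) := by positivity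
  have hc0 : 0 ≤ c := by linarith
  clear_value cu c₅ c
  obtain ⟨g, κ, C, hκ, hC, hdom⟩ := exists_dominating_gain hlam hc0 (Nat.cast_nonneg (α := ℝ) N)
  refine ⟨g, κ, C, hκ, hC, fun v x dx z dz γ γs dγ dγs hv hcl => ?_⟩
  obtain ⟨s, w, u, hs, hw, hu, hdx, hdz, -⟩ := hcl
  set e := D.err x z with he
  set X := l2norm x with hX
  set Y := D.consensusNorm a e with hY
  set Z := D.detectableNorm e with hZ
  have hX0 : 0 ≤ X := l2norm_nonneg x
  have hY0 : 0 ≤ Y := D.consensusNorm_nonneg a e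
  have hZ0 : 0 ≤ Z := D.detectableNorm_nonneg e
  have hxhat : ∀ i, D.xhat x z i = x + e i := fun i => by rw [he, ObserverDesign.err]; abel
  simp only [hxhat] at hs hu
  simp only [ObserverDesign.epsu_eq, ← he] at hw hdz ⊢
  have hderr : ∀ i, D.err dx dz i = D.Td i *ᵥ (D.E i *ᵥ ((D.Td i)ᵀ *ᵥ e i))
      + D.Tu i *ᵥ ((D.Tu i)ᵀ *ᵥ (S.A *ᵥ e i - S.hiddenInput u v i)
        - γ i • ((D.Tu i)ᵀ *ᵥ lap a e i) - γs i • w i) :=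
    fun i => D.error_dynamics i hdx (hdz i)
  clear_value e
  have hV : energy P a x e ≤ c * (X ^ 2 + (Y + Z) ^ 2) := by
    have h1 := (le_abs_self _).trans (abs_dotProduct_mulVec_le P x x)
    have h2 : ∑ i, e i ⬝ᵥ lap a e i ≤ N * (c₀ * (cL * c₀) * (Y + Z) ^ 2) := by
      refine (Finset.sum_le_card_nsmul _ _ (c₀ * (cL * c₀) * (Y + Z) ^ 2) fun i _ => ?_).trans_eq
        (by simp)
      refine (dotProduct_le_l2norm _ _).trans ((mul_le_mul (hrec e i) (hlap e _ (hrec e) i)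
        (l2norm_nonneg _) (by positivity)).trans_eq (by ring))
    have h3 : 0 ≤ (N * (c₀ * (cL * c₀))) * (Y + Z) ^ 2 := by positivity
    have h4 : opNorm2 P * X ^ 2 ≤ c * X ^ 2 :=
      mul_le_mul_of_nonneg_right (by rw [hc]; linarith) (sq_nonneg X)
    have h5 : (N * (c₀ * (cL * c₀))) * (Y + Z) ^ 2 ≤ c * (Y + Z) ^ 2 :=
      mul_le_mul_of_nonneg_right (by rw [hc]; linarith) (sq_nonneg _)
    rw [energy]
    linarith
  have hplant' := hplant x (fun κ => e (node κ)) (c₀ * (Y + Z)) v s hv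
    (fun κ => hrec e (node κ)) hs
  simp only [← hu] at hplant'
  rw [← hdx] at hplant'
  have hU : ∑ κ, l2norm (u κ) ≤ cu * (X + c₀ * (Y + Z) + 1) := by
    rw [hcu, Finset.sum_mul]
    refine Finset.sum_le_sum fun κ _ => ?_
    have h1 : l2norm (x + e (node κ)) ≤ X + c₀ * (Y + Z) :=
      (l2norm_add_le _ _).trans (add_le_add_right (hrec e _) _)
    have h2 := (l2norm_mulVec_le (K κ) (x + e (node κ))).trans
      (mul_le_mul_of_nonneg_left h1 (opNorm2_nonneg _))
    have h3 := l2norm_sub_le (K κ *ᵥ (x + e (node κ))) (β κ • s κ)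
    rw [l2norm_smul] at h3
    have h4 := mul_le_mul_of_nonneg_left (l2norm_le_one_of_mem_hSet (hs κ)) (abs_nonneg (β κ))
    have h5 : 0 ≤ |β κ| * (X + c₀ * (Y + Z)) := by positivity
    have h6 := opNorm2_nonneg (K κ)
    rw [hu κ]
    linarith
  -- The controls grow linearly in X, Y, Z; the constant 1 accounts for the switching terms and the
  -- disturbance.
  have hhid : ∀ i, l2norm (S.hiddenInput u v i) ≤ c₅ * (X + Y + Z + 1) := fun i => by
    refine (hhidden u v i).trans ?_
    rw [hc₅, mul_assoc c₃]
    refine mul_le_mul_of_nonneg_left ?_ hc₃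
    have h1 : 0 ≤ cu * (c₀ * (X + 1)) := by positivity
    have h2 : 0 ≤ cu * (Y + Z) := by positivity
    have h3 : 0 ≤ |vbar| * (X + Y + Z) := by positivity
    linarith [le_abs_self vbar]
  have hsumY : Y = ∑ i, l2norm ((D.Tu i)ᵀ *ᵥ lap a e i) := rfl
  have hobs' := hobs e (S.hiddenInput u v) γ γs w _ hhid hw
  simp only [← hderr] at hobs'
  set Y₂ := ∑ i, l2norm ((D.Tu i)ᵀ *ᵥ lap a e i) ^ 2 with hY₂
  have hYY : Y ^ 2 ≤ N * Y₂ := by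
    rw [hsumY, hY₂]
    simpa using sq_sum_le_card_mul_sum_sq (s := Finset.univ)
      (f := fun i => l2norm ((D.Tu i)ᵀ *ᵥ lap a e i))
  have hfin := hdom X Y Z Y₂ _ hX0 hY0 hZ0 hYY (Finset.sum_nonneg fun _ _ => sq_nonneg _) hV
  simp only [sub_mul, Finset.sum_sub_distrib, ← Finset.mul_sum]
  rw [← hsumY, ← hY₂]
  have h1 : c₁ * (X * (c₀ * (Y + Z)) + c₀ * (Y + Z)) + c₄ * ((Y + Z) * Z
        + Y * (Y + Z + c₅ * (X + Y + Z + 1)))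
      ≤ c * (X * (Y + Z) + (Y + Z) + (Y + Z) * Z + Y * (X + Y + Z + 1)) := by
    have e1 : 0 ≤ c₁ * c₀ * ((Y + Z) * Z + Y * (X + Y + Z + 1)) := by positivity
    have e2 : 0 ≤ c₄ * (1 + c₅) * (X * (Y + Z) + (Y + Z)) := by positivity
    have e3 : 0 ≤ (opNorm2 P + N * (c₀ * (cL * c₀)))
        * (X * (Y + Z) + (Y + Z) + (Y + Z) * Z + Y * (X + Y + Z + 1)) := by positivity
    have e4 : 0 ≤ c₄ * c₅ * ((Y + Z) * Z) := by positivity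
    have e5 : 0 ≤ c₄ * (Y * (X + 1)) := by positivity
    rw [hc]
    linarith
  linarith

/-! ### Estimates along a closed-loop solution -/

section Trajectory

variable {D : ObserverDesign S δ} {a : Matrix (Fin N) (Fin N) ℝ}
  {K : ∀ κ, Matrix (Fin (b κ)) (Fin n) ℝ} {P : Matrix (Fin n) (Fin n) ℝ} {β : Fin Nc → ℝ}
  {node : Fin Nc → Fin N} {v : ℝ → Fin mv → ℝ} {x : ℝ → Fin n → ℝ} {z : Fin N → ℝ → Fin n → ℝ}
  {γ γs : Fin N → ℝ → ℝ}

theorem IsClosedLoopSolution.vecLocAC_err (hsol : IsClosedLoopSolution D a K P β node v x z γ γs)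
    (i : Fin N) : VecLocAC fun t => D.err (x t) (fun j => z j t) i := by
  have hx := VecLocAC.of_absolutelyContinuousOnInterval hsol.ac_x
  have hz := VecLocAC.of_absolutelyContinuousOnInterval (hsol.ac_z i)
  exact (hz.add ((hx.mulVec (S.C i)).mulVec (D.Gbar i))).sub hx

theorem hasDerivAt_err (D : ObserverDesign S δ) {dx : Fin n → ℝ} {dz : Fin N → Fin n → ℝ} {t : ℝ}
    (hx : HasDerivAt x dx t) (hz : ∀ i, HasDerivAt (z i) (dz i) t) (i : Fin N) :
    HasDerivAt (fun t => D.err (x t) (fun j => z j t) i) (D.err dx dz i) t :=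
  ((hz i).add (hasDerivAt_mulVec (D.Gbar i) (hasDerivAt_mulVec (S.C i) hx))).sub hx

/-- The detectable part of each estimation error decays exponentially. -/
theorem IsClosedLoopSolution.exists_detectable_decay
    (hsol : IsClosedLoopSolution D a K P β node v x z γ γs) (i : Fin N) :
    ∃ M c : ℝ, 0 ≤ M ∧ 0 < c ∧ ∀ t, 0 ≤ t →
      l2norm ((D.Td i)ᵀ *ᵥ D.err (x t) (fun j => z j t) i) ≤ M * Real.exp (-c * t) := by
  set y := fun t => (D.Td i)ᵀ *ᵥ D.err (x t) (fun j => z j t) i with hy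
  have hac : VecLocAC y := (hsol.vecLocAC_err i).mulVec _
  have hder : ∀ᵐ t ∂(volume.restrict (Set.Ioi (0 : ℝ))), HasDerivAt y (D.E i *ᵥ y t) t := by
    filter_upwards [hsol.inclusion] with t ⟨dx, dz, dγ, dγs, hdx, hdz, _, _, hcl⟩
    have := hasDerivAt_mulVec (D.Td i)ᵀ (hasDerivAt_err D hdx hdz i)
    rwa [hcl.err_deriv i] at this
  rcases D.stable i with hE | ⟨hE, hGC⟩
  · obtain ⟨R, hR, hlow, c, hc, hneg⟩ := hE.exists_lyapunov
    have hR0 := opNorm2_nonneg R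
    set c' := c / (opNorm2 R + 1) with hc'
    have hc'0 : 0 < c' := by positivity
    have hdecay := (hac.dotProduct (hac.mulVec R)).le_exp (c := c') (by
      filter_upwards [hder] with t ht
      refine ⟨_, (hneg (y t)).trans ?_, hasDerivAt_quadratic hR ht⟩
      have h1 := (le_abs_self _).trans (abs_dotProduct_mulVec_le R (y t) (y t))
      have h2 : c' * (y t ⬝ᵥ R *ᵥ y t) ≤ c' * ((opNorm2 R + 1) * l2norm (y t) ^ 2) :=
        mul_le_mul_of_nonneg_left (by nlinarith [sq_nonneg (l2norm (y t))]) hc'0.le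
      rw [hc', ← mul_assoc, div_mul_cancel₀ c (by positivity)] at h2
      rw [← hc'] at h2
      linarith)
    set f₀ := y 0 ⬝ᵥ R *ᵥ y 0 with hf₀
    have hf₀0 : 0 ≤ f₀ := (sq_nonneg _).trans (hlow (y 0))
    -- The quadratic form decays at rate c'; passing to the norm halves it.
    refine ⟨√f₀, c' / 2, Real.sqrt_nonneg _, by positivity, fun t ht => ?_⟩
    refine le_of_sq_le_sq ?_ (by positivity)
    rw [mul_pow, Real.sq_sqrt hf₀0, ← Real.exp_nat_mul]
    refine (hlow (y t)).trans ((hdecay t ht).trans_eq ?_)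
    congr 2
    push_cast
    ring
  -- In the static branch the detectable error is constant. It starts at zero because z_i(0) = 0 and
  -- G_iC_i = T_idᵀ.
  · have hzero := (hac.dotProduct hac).le_exp (c := 0) (by
      filter_upwards [hder] with t ht
      rw [hE, zero_mulVec] at ht
      exact ⟨_, by simp, hasDerivAt_dotProduct ht ht⟩)
    have hy0 : y 0 = 0 := by
      simp only [hy, ObserverDesign.err, ObserverDesign.xhat, hsol.z_zero, zero_add]
      rw [ObserverDesign.Gbar, ← mulVec_mulVec, mulVec_sub, mulVec_mulVec, D.Td_orth, one_mulVec,
        mulVec_mulVec, hGC, sub_self]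
    refine ⟨0, 1, le_rfl, one_pos, fun t ht => ?_⟩
    have h1 := hzero t ht
    simp only [hy0, zero_dotProduct, zero_mul, ← l2norm_sq] at h1
    rw [zero_mul]
    exact (pow_eq_zero_iff two_ne_zero).1 (le_antisymm h1 (sq_nonneg _)) |>.le

theorem IsClosedLoopSolution.exists_detectableNorm_decay
    (hsol : IsClosedLoopSolution D a K P β node v x z γ γs) :
    ∃ M c : ℝ, 0 ≤ M ∧ 0 < c ∧ ∀ t, 0 ≤ t →
      D.detectableNorm (D.err (x t) (fun j => z j t)) ≤ M * Real.exp (-c * t) := by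
  choose M c hM hc hle using hsol.exists_detectable_decay
  obtain ⟨B, hB0, hB⟩ := exists_uniform_bound fun i => 1 / c i
  have hmin : ∀ i, 1 / (B + 1) ≤ c i := fun i => by
    rw [div_le_iff₀ (by linarith)]
    have := (div_le_iff₀ (hc i)).1 (hB i)
    nlinarith [hc i]
  refine ⟨∑ i, M i, 1 / (B + 1), Finset.sum_nonneg fun i _ => hM i, by positivity,
    fun t ht => ?_⟩
  rw [ObserverDesign.detectableNorm, Finset.sum_mul]
  refine Finset.sum_le_sum fun i _ => (hle i t ht).trans (mul_le_mul_of_nonneg_left ?_ (hM i))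
  exact Real.exp_le_exp.2 (by nlinarith [mul_le_mul_of_nonneg_right (hmin i) ht])

theorem hasDerivAt_energy {a : Matrix (Fin N) (Fin N) ℝ} (ha : ∀ i j, a i j = a j i)
    {P : Matrix (Fin n) (Fin n) ℝ} (hP : Pᵀ = P) {e : ℝ → Fin N → Fin n → ℝ} {dx : Fin n → ℝ}
    {de : Fin N → Fin n → ℝ} {t : ℝ} (hx : HasDerivAt x dx t)
    (he : ∀ i, HasDerivAt (fun t => e t i) (de i) t) :
    HasDerivAt (fun t => energy P a (x t) (e t))
      (2 * (x t ⬝ᵥ P *ᵥ dx) + ∑ i, de i ⬝ᵥ lap a (e t) i) t := by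
  have hlap : ∀ i, HasDerivAt (fun t => lap a (e t) i) (lap a de i) t := fun i =>
    HasDerivAt.fun_sum fun j _ => ((he i).sub (he j)).const_smul (a i j)
  have h1 : HasDerivAt (fun t => ∑ i, e t i ⬝ᵥ lap a (e t) i)
      (∑ i, (de i ⬝ᵥ lap a (e t) i + e t i ⬝ᵥ lap a de i)) t :=
    HasDerivAt.fun_sum fun i _ => hasDerivAt_dotProduct (he i) (hlap i)
  have h2 := (hasDerivAt_quadratic hP hx).add (h1.const_mul (1 / 2))
  refine h2.congr_deriv ?_
  rw [Finset.sum_add_distrib, sum_dotProduct_lap_comm ha de (e t)]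
  ring

theorem locAC_energy (P : Matrix (Fin n) (Fin n) ℝ) (a : Matrix (Fin N) (Fin N) ℝ)
    {e : ℝ → Fin N → Fin n → ℝ} (hx : VecLocAC x) (he : ∀ i, VecLocAC fun t => e t i) :
    LocAC fun t => energy P a (x t) (e t) := by
  refine (hx.dotProduct (hx.mulVec P)).add (LocAC.const_mul _ (LocAC.sum _ fun i _ => ?_))
  exact (he i).dotProduct (VecLocAC.sum _ fun j _ => ((he i).sub (he j)).const_smul _)

/-- Weighted squared deviation of the adaptive gains from the level `g`. -/
def gainEnergy (φ : Fin N → ℝ) (g : ℝ) (γ : Fin N → ℝ) : ℝ :=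
  ∑ i, 1 / (2 * φ i) * ((γ i - g) * (γ i - g))

theorem gainEnergy_nonneg {φ : Fin N → ℝ} (hφ : ∀ i, 0 < φ i) (g : ℝ) (γ : Fin N → ℝ) :
    0 ≤ gainEnergy φ g γ :=
  Finset.sum_nonneg fun i _ => mul_nonneg (by have := hφ i; positivity) (mul_self_nonneg _)

theorem locAC_gainEnergy (φ : Fin N → ℝ) (g : ℝ) (hγ : ∀ i, LocAC (γ i)) :
    LocAC fun t => gainEnergy φ g fun i => γ i t :=
  LocAC.sum _ fun i _ =>
    (((hγ i).sub (LocAC.const g)).mul ((hγ i).sub (LocAC.const g))).const_mul _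

/-- The weight 1/(2φ_i) cancels the step size. Added to the energy balance, this derivative turns
each -γ_i f_i into -g f_i. -/
theorem hasDerivAt_gainEnergy {φ : Fin N → ℝ} (hφ : ∀ i, 0 < φ i) (g : ℝ) {f : Fin N → ℝ}
    {t : ℝ} (hγ : ∀ i, HasDerivAt (γ i) (φ i * f i) t) :
    HasDerivAt (fun t => gainEnergy φ g fun i => γ i t) (∑ i, (γ i t - g) * f i) t := by
  refine (HasDerivAt.fun_sum fun i _ => (((hγ i).sub_const g).mul
    ((hγ i).sub_const g)).const_mul (1 / (2 * φ i))).congr_deriv ?_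
  refine Finset.sum_congr rfl fun i _ => ?_
  have := (hφ i).ne'
  field_simp
  ring

theorem exists_gain_bound {φ : Fin N → ℝ} (hφ : ∀ i, 0 < φ i) (g : ℝ) {B : ℝ}
    (hB : ∀ t, 0 ≤ t → gainEnergy φ g (fun i => γ i t) ≤ B) (i : Fin N) :
    ∃ M : ℝ, ∀ t, 0 ≤ t → |γ i t| ≤ M := by
  refine ⟨|g| + (2 * φ i * B + 1), fun t ht => ?_⟩
  have h0 : 0 < 2 * φ i := by linarith [hφ i]
  have h1 : 1 / (2 * φ i) * ((γ i t - g) * (γ i t - g)) ≤ B :=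
    (Finset.single_le_sum (f := fun i => 1 / (2 * φ i) * ((γ i t - g) * (γ i t - g)))
      (fun j _ => mul_nonneg (by have := hφ j; positivity) (mul_self_nonneg _))
      (Finset.mem_univ i)).trans (hB t ht)
  rw [div_mul_eq_mul_div, one_mul, div_le_iff₀ h0] at h1
  have h2 : |γ i t - g| ≤ 2 * φ i * B + 1 := by
    have h3 : |γ i t - g| * |γ i t - g| = (γ i t - g) * (γ i t - g) := abs_mul_abs_self _
    nlinarith [sq_nonneg (|γ i t - g| - 1)]
  have h4 := abs_add_le g (γ i t - g)
  rw [add_sub_cancel] at h4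
  linarith

/-- Convergence of the gain part is what permits a limit of V to be extracted from a limit of V + Q.
-/
theorem exists_tendsto_gainEnergy (φ : Fin N → ℝ) (g : ℝ)
    (hγ : ∀ i, MonotoneOn (γ i) (Set.Ici 0)) (hM : ∀ i, ∃ M : ℝ, ∀ t, 0 ≤ t → |γ i t| ≤ M) :
    ∃ L, Tendsto (fun t => gainEnergy φ g fun i => γ i t) atTop (𝓝 L) := by
  have hlim : ∀ i, ∃ L, Tendsto (γ i) atTop (𝓝 L) := fun i => by
    obtain ⟨M, hM⟩ := hM i
    exact exists_tendsto_of_monotoneOn (hγ i) fun t ht => (le_abs_self _).trans (hM t ht)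
  choose L hL using hlim
  exact ⟨_, tendsto_finsetSum _ fun i _ =>
    (((hL i).sub_const g).mul ((hL i).sub_const g)).const_mul _⟩

end Trajectory

end ClosedLoopAnalysis

/-! ### From the dissipation inequality to the limits -/

theorem tendsto_zero_of_sq_le {f g : ℝ → ℝ} (hf : ∀ t, 0 ≤ f t) (hfg : ∀ t, f t ^ 2 ≤ g t)
    (hg : Tendsto g atTop (𝓝 0)) : Tendsto f atTop (𝓝 0) := by
  refine squeeze_zero hf (fun t => Real.le_sqrt_of_sq_le (hfg t)) ?_
  simpa [Function.comp_def] using (Real.continuous_sqrt.tendsto 0).comp hg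

end DistSMC

end

theorem theorem5
    {n m mv N Nc : ℕ} {b : Fin Nc → ℕ} {p q r : Fin N → ℕ}
    (S : DistSMC.Plant n m mv N Nc b p q r)
    (G : SimpleGraph (Fin N)) (a : Matrix (Fin N) (Fin N) ℝ)
    (ha : DistSMC.IsWeightedAdjacency G a) (hG : G.Connected)
    (δ : Fin N → ℕ) (D : DistSMC.ObserverDesign S δ)
    (hdet : D.CollectivelyDetectable)
    (hstab : DistSMC.IsStabilizable S.A S.B)
    (Bt : Matrix ((κ : Fin Nc) × Fin (b κ)) (Fin m) ℝ)
    (hBt : S.B = DistSMC.blockRow S.Bc * Bt)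
    (Xv : Matrix (Fin m) (Fin mv) ℝ) (hmatch : S.B * Xv = S.Bv)
    (v : ℝ → Fin mv → ℝ) (vbar : ℝ) (hv : ∀ t, 0 ≤ t → DistSMC.l2norm (v t) ≤ vbar)
    (K : ∀ κ, Matrix (Fin (b κ)) (Fin n) ℝ) (P : Matrix (Fin n) (Fin n) ℝ)
    (hP : P.PosDef)
    (hLyap : (-((S.A + ∑ κ, S.Bc κ * K κ)ᵀ * P + P * (S.A + ∑ κ, S.Bc κ * K κ))).PosDef)
    (β : Fin Nc → ℝ) (hβ : ∀ κ, vbar * DistSMC.opNorm2 (Bt * Xv) ≤ β κ)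
    (node : Fin Nc → Fin N)
    (x : ℝ → Fin n → ℝ) (z : Fin N → ℝ → Fin n → ℝ) (γ γs : Fin N → ℝ → ℝ)
    (hsol : DistSMC.IsClosedLoopSolution D a K P β node v x z γ γs) :
    Tendsto (fun t => DistSMC.l2norm (x t)) atTop (𝓝 0) ∧
    (∀ i, Tendsto (fun t => DistSMC.l2norm (D.xhat (x t) (fun j => z j t) i - x t))
      atTop (𝓝 0)) ∧
    (∀ i, ∃ M : ℝ, ∀ t, 0 ≤ t → |γ i t| ≤ M ∧ |γs i t| ≤ M) := by
  open DistSMC in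
  have hPsymm : Pᵀ = P := by simpa using hP.isHermitian.eq
  obtain ⟨g, κ, C, hκ, hC, hdiss⟩ := D.exists_dissipation hdet ha hG Bt hBt Xv hmatch K hPsymm
    hLyap hβ node
  obtain ⟨M, c, hM, hc, hdecay⟩ := hsol.exists_detectableNorm_decay
  obtain ⟨c₀, hc₀, hrec⟩ := D.exists_norm_le hdet ha hG
  obtain ⟨cP, hcP, hPlow⟩ := exists_pos_quadratic_lower_bound hP
  obtain ⟨cL, hcL, hlap⟩ := exists_lap_sq_le (k := Fin n) ha.symm ha.nonneg
  set e : ℝ → Fin N → Fin n → ℝ := fun t => D.err (x t) fun j => z j t with he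
  set V : ℝ → ℝ := fun t => energy P a (x t) (e t) with hVdef
  set Q : ℝ → ℝ := fun t => gainEnergy D.φ g (fun i => γ i t) + gainEnergy D.φs g fun i => γs i t
    with hQ
  have hQdef : ∀ t, Q t = gainEnergy D.φ g (fun i => γ i t)
      + gainEnergy D.φs g fun i => γs i t := fun _ => rfl
  have hquad : ∀ t, cP * l2norm (x t) ^ 2 ≤ V t := fun t => by
    have := sum_dotProduct_lap_nonneg ha.symm ha.nonneg (e t)
    have := hPlow (x t)
    simp only [hVdef, energy]
    linarith
  have hdis : ∀ t, ∑ i, e t i ⬝ᵥ lap a (e t) i ≤ 2 * V t := fun t => by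
    have := hPlow (x t)
    have := mul_nonneg hcP.le (sq_nonneg (l2norm (x t)))
    simp only [hVdef, energy]
    linarith
  have hV0 : ∀ t, 0 ≤ V t := fun t => (mul_nonneg hcP.le (sq_nonneg _)).trans (hquad t)
  have hQγ : ∀ t, 0 ≤ gainEnergy D.φ g fun i => γ i t := fun t => gainEnergy_nonneg D.φ_pos _ _
  have hQγs : ∀ t, 0 ≤ gainEnergy D.φs g fun i => γs i t :=
    fun t => gainEnergy_nonneg D.φs_pos _ _
  have hac : LocAC fun t => V t + Q t :=
    (locAC_energy P a (VecLocAC.of_absolutelyContinuousOnInterval hsol.ac_x)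
      hsol.vecLocAC_err).add
      ((locAC_gainEnergy D.φ g hsol.ac_γ).add (locAC_gainEnergy D.φs g hsol.ac_γs))
  have hder : ∀ᵐ t ∂(volume.restrict (Set.Ioi (0 : ℝ))),
      ∃ d ≤ -κ * V t + C * (M + M ^ 2) * Real.exp (-c * t),
        HasDerivAt (fun t => V t + Q t) d t := by
    filter_upwards [hsol.inclusion, ae_restrict_mem measurableSet_Ioi] with t
      ⟨dx, dz, dγ, dγs, hdx, hdz, hdγ, hdγs, hcl⟩ ht
    have ht0 : (0 : ℝ) ≤ t := (Set.mem_Ioi.1 ht).le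
    have hineq := hdiss _ _ _ _ _ _ _ _ _ (hv t ht0) hcl
    obtain ⟨-, -, -, -, -, -, -, -, hγ, hγs⟩ := hcl
    simp only [hγ] at hdγ
    simp only [hγs] at hdγs
    refine ⟨_, ?_, (hasDerivAt_energy ha.symm hPsymm hdx (hasDerivAt_err D hdx hdz)).add
      ((hasDerivAt_gainEnergy D.φ_pos g hdγ).add (hasDerivAt_gainEnergy D.φs_pos g hdγs))⟩
    rw [← add_assoc]
    refine hineq.trans (add_le_add_right ?_ _)
    rw [mul_assoc]
    refine mul_le_mul_of_nonneg_left ?_ hC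
    have h1 := hdecay t ht0
    have h2 := pow_le_pow_left₀ (D.detectableNorm_nonneg _) h1 2
    have h3 : Real.exp (-c * t) ≤ 1 := Real.exp_le_one_iff.2 (by nlinarith)
    -- This merges Z and Z² into one exponential with coefficient M + M².
    have h4 : Real.exp (-c * t) ^ 2 ≤ Real.exp (-c * t) := by
      nlinarith [Real.exp_pos (-c * t)]
    rw [mul_pow] at h2
    nlinarith [mul_le_mul_of_nonneg_left h4 (sq_nonneg M)]
  have hC' : 0 ≤ C * (M + M ^ 2) := by positivity
  have hbound := (hac.bounded_of_perturbed hV0 hκ hC' hc hder).2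
  have hbγ := exists_gain_bound D.φ_pos g (γ := γ) fun t ht =>
    (by linarith [hV0 t, hQγs t, hQdef t] : _ ≤ V t + Q t).trans (hbound t ht)
  have hbγs := exists_gain_bound D.φs_pos g (γ := γs) fun t ht =>
    (by linarith [hV0 t, hQγ t, hQdef t] : _ ≤ V t + Q t).trans (hbound t ht)
  have hmγ : ∀ i, MonotoneOn (γ i) (Set.Ici 0) := fun i => LocAC.monotoneOn (hsol.ac_γ i) (by
    filter_upwards [hsol.inclusion] with t
      ⟨_, _, _, _, _, _, hdγ, _, _, _, _, _, _, _, _, _, hγ, _⟩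
    exact ⟨_, (hγ i).symm ▸ mul_nonneg (D.φ_pos i).le (sq_nonneg _), hdγ i⟩)
  have hmγs : ∀ i, MonotoneOn (γs i) (Set.Ici 0) := fun i => LocAC.monotoneOn (hsol.ac_γs i) (by
    filter_upwards [hsol.inclusion] with t
      ⟨_, _, _, _, _, _, _, hdγs, _, _, _, _, _, _, _, _, _, hγs⟩
    exact ⟨_, (hγs i).symm ▸ mul_nonneg (D.φs_pos i).le (l2norm_nonneg _), hdγs i⟩)
  obtain ⟨L₁, hL₁⟩ := exists_tendsto_gainEnergy D.φ g hmγ hbγ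
  obtain ⟨L₂, hL₂⟩ := exists_tendsto_gainEnergy D.φs g hmγs hbγs
  have hVlim : Tendsto V atTop (𝓝 0) :=
    hac.tendsto_zero_of_perturbed hV0 (fun t => add_nonneg (hQγ t) (hQγs t)) hκ hC' hc hder
      (hL₁.add hL₂)
  have hlaplim : ∀ i, Tendsto (fun t => l2norm (lap a (e t) i)) atTop (𝓝 0) := fun i =>
    tendsto_zero_of_sq_le (g := fun t => cL * (2 * V t)) (fun _ => l2norm_nonneg _)
      (fun t => (hlap (e t) i).trans (mul_le_mul_of_nonneg_left (hdis t) hcL))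
      (by simpa using (hVlim.const_mul 2).const_mul cL)
  -- V → 0 reaches the errors only through Le; the exponential decay of Z supplies the missing
  -- consensus directions.
  have hYlim : Tendsto (fun t => D.consensusNorm a (e t)) atTop (𝓝 0) := by
    refine squeeze_zero (fun t => D.consensusNorm_nonneg a (e t))
      (fun t => Finset.sum_le_sum fun i _ => l2norm_mulVec_le (D.Tu i)ᵀ (lap a (e t) i)) ?_
    simpa using tendsto_finsetSum Finset.univ fun i _ =>
      (hlaplim i).const_mul (opNorm2 (D.Tu i)ᵀ)
  have hZlim : Tendsto (fun t => D.detectableNorm (e t)) atTop (𝓝 0) :=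
    squeeze_zero' (Eventually.of_forall fun t => D.detectableNorm_nonneg (e t))
      ((eventually_ge_atTop 0).mono hdecay) (tendsto_const_mul_exp_neg M hc)
  refine ⟨?_, fun i => ?_, fun i => ?_⟩
  · refine tendsto_zero_of_sq_le (g := fun t => V t / cP) (fun _ => l2norm_nonneg _)
      (fun t => ?_) (by simpa using hVlim.div_const cP)
    rw [le_div_iff₀ hcP]
    linarith [hquad t]
  · exact squeeze_zero (fun _ => l2norm_nonneg _) (fun t => hrec (e t) i)
      (by simpa using (hYlim.add hZlim).const_mul c₀)
  · obtain ⟨M₁, h₁⟩ := hbγ i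
    obtain ⟨M₂, h₂⟩ := hbγs i
    exact ⟨max M₁ M₂, fun t ht => ⟨(h₁ t ht).trans (le_max_left _ _),
      (h₂ t ht).trans (le_max_right _ _)⟩⟩
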